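/- \textbf{Conventions.} A \emph{pseudogroup} on a topological space $Z$ is a collection $\mathcal H$ of homeomorphisms between open subsets of $Z$ that contains $\mathrm{id}_Z$ and is closed under composition (on the maximal domain), inversion, restriction to open sets and combination. It is \emph{generated} by $S\subset\mathcal H$ if every element of $\mathcal H$ can be obtained from elements of $S$ by composition, inversion, restriction to open sets and combination (so the domains of the elements of $S$ cover $Z$); $S$ is \emph{symmetric} if $h^{-1}\in S$ whenever $h\in S$. The \emph{orbit} of $x$ is $\mathcal H(x)=\{h(x): h\in\mathcal H,\ x\in\operatorname{dom}h\}$. $\mathcal H$ is \emph{compactly generated} if there is an open set $U\subset Z$ with compact closure that meets every orbit and such that the restriction of $\mathcal H$ to $U$ (the elements of $\mathcal H$ with domain and image in $U$) is generated by a finite symmetric set $E$, each $g\in E$ being the restriction of some $\bar g\in\mathcal H$ defined on a neighborhood of the closure of $\operatorname{dom}g$. A set $S$ of homeomorphisms between open subsets of $Z$ satisfies \emph{the condition of quasi-effectiveness} if every $h\in S$ that is the identity on some non-empty open subset of its domain is the identity on its domain. $\mathcal H$ is \emph{quasi-effective} if it is generated by some symmetric set $S$ that is closed under compositions and satisfies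 this condition. A \emph{cover of $Z$ by quasi-locally equal metric spaces} is a family $\{(Z_i,d_i)\}_{i\in I}$ of metric spaces with $\bigcup_iZ_i=Z$, such that each $Z_i\cap Z_j$ is open in $(Z_i,d_i)$ and in $(Z_j,d_j)$, and such that for every $\epsilon>0$ there is some $\delta(\epsilon)>0$ with the following property: for all $i,j\in I$ and $z\in Z_i\cap Z_j$ there is a neighborhood $U_{i,j,z}$ of $z$ in $Z_i\cap Z_j$, open for $d_i$ and for $d_j$, such that $d_i(x,y)<\delta(\epsilon)\Rightarrow d_j(x,y)<\epsilon$ for all $\epsilon>0$ and all $x,y\in U_{i,j,z}$. It induces the topology of $Z$ if the open balls of all the $(Z_i,d_i)$ form a base of that topology. A set $S$ of homeomorphisms between open subsets of $Z$ satisfies \emph{the condition of strong equicontinuity} if there is such a cover, inducing the topology of $Z$, such that for every $\epsilon>0$ there is some $\delta>0$ with $d_i(x,y)<\delta\Rightarrow d_j(h(x),h(y))<\epsilon$ for all $h\in S$, all $i,j\in I$ and all $x,y\in Z_i\cap h^{-1}(Z_j\cap\operatorname{im}h)$. $\mathcal H$ is \emph{strongly equicontinuous} if it is generated by some symmetric set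 $S$ that is closed under compositions and satisfies this condition. \textbf{Theorem.} Let $\mathcal H$ be a quasi-effective, compactly generated and strongly equicontinuous pseudogroup on a locally compact Polish space $Z$. Then there are symmetric sets $S$ of generators of $\mathcal H$ that are closed under compositions and restrictions to open sets and satisfy the conditions of strong equicontinuity and of quasi-effectiveness. For any such $S$, let $\widetilde{\mathcal H}$ be the set of maps $h$ between open subsets of $Z$ such that every $x\in\operatorname{dom}h$ has a neighborhood $O_x$ in $\operatorname{dom}h$ for which $h|_{O_x}$ is in the closure of $C(O_x,Z)\cap S$ (the set of elements of $S$ with domain $O_x$) in $C(O_x,Z)$ with the compact-open topology. Then: \begin{itemize} \item $\widetilde{\mathcal H}$ is closed under composition, combination and restriction to open sets; \item every map in $\widetilde{\mathcal H}$ is a homeomorphism around every point of its domain (it is a local homeomorphism); \item the maps in $\widetilde{\mathcal H}$ that are homeomorphisms form a pseudogroup $\overline{\mathcal H}$ that contains $\mathcal H$; \item $\overline{\mathcal H}$ is strongly equicontinuous; \item the orbits of $\overline{\mathcal H}$ are the closures of the orbits of $\mathcal H$: $\overline{\mathcal H}(x)=\overline{\mathcal H(x)}$ for every $x\in Z$;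 \item $\widetilde{\mathcal H}$ and $\overline{\mathcal H}$ do not depend on the choice of $S$. \end{itemize} -/

import Mathlib

open Set Topology TopologicalSpace

universe u

namespace PseudogroupClosure

/-! ### Pseudogroups

A local transformation of `Z` (a homeomorphism between open subsets of `Z`) is an
`OpenPartialHomeomorph Z Z`, considered up to the relation `≈` (same source, same values on the
source).  A pseudogroup is a `StructureGroupoid Z` (it contains the identity, and is closed under
composition with maximal domain, inversion, combination and `≈`) that is moreover
`ClosedUnderRestriction`. -/

section Pseudogroups

variable {Z : Type u} [TopologicalSpace Z]

/-- The local transformations that are obtained from the elements of `E` by composition,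
inversion, restriction to open sets and combination. -/
inductive Generated (E : Set (OpenPartialHomeomorph Z Z)) : OpenPartialHomeomorph Z Z → Prop
  | basic (e : OpenPartialHomeomorph Z Z) (he : e ∈ E) : Generated E e
  | comp (e e' : OpenPartialHomeomorph Z Z) (he : Generated E e) (he' : Generated E e') :
      Generated E (e.trans e')
  | inv (e : OpenPartialHomeomorph Z Z) (he : Generated E e) : Generated E e.symm
  | restr (e : OpenPartialHomeomorph Z Z) (s : Set Z) (hs : IsOpen s) (he : Generated E e) :
      Generated E (e.restr s)
  | combination (e : OpenPartialHomeomorph Z Z) (s : Z → Set Z)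
      (hs : ∀ x ∈ e.source, IsOpen (s x)) (hx : ∀ x ∈ e.source, x ∈ s x)
      (he : ∀ x ∈ e.source, Generated E (e.restr (s x))) : Generated E e
  | congr (e e' : OpenPartialHomeomorph Z Z) (he : Generated E e) (h : e' ≈ e) : Generated E e'

/-- The orbit `H(x)`. -/
def orbit (H : StructureGroupoid Z) (x : Z) : Set Z :=
  {y | ∃ h ∈ H, x ∈ h.source ∧ h x = y}

/-- `S` is a symmetric set of generators of `H` that is closed under compositions.
(The field `congr` says that `S` is a set of local transformations, that is, that membership of
an `OpenPartialHomeomorph` depends only on its restriction to its source.) -/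
structure IsGeneratingSystem (H : StructureGroupoid Z) (S : Set (OpenPartialHomeomorph Z Z)) :
    Prop where
  subset : ∀ e ∈ S, e ∈ H
  generates : ∀ h ∈ H, Generated S h
  symm : ∀ e ∈ S, e.symm ∈ S
  comp : ∀ e ∈ S, ∀ e' ∈ S, e.trans e' ∈ S
  congr : ∀ e ∈ S, ∀ e', e' ≈ e → e' ∈ S

/-- `H` is compactly generated: there are a relatively compact open set `U` that meets every orbit
and a finite symmetric set `E` which generates the restriction of `H` to `U` (the set of elements of
`H` with source and target in `U`), such that each `g ∈ E` is the restriction of some `g' ∈ H`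
whose source is a neighborhood of the closure of the source of `g`. -/
def IsCompactlyGenerated (H : StructureGroupoid Z) : Prop :=
  ∃ U : Set Z, IsOpen U ∧ IsCompact (closure U) ∧ (∀ x : Z, (orbit H x ∩ U).Nonempty) ∧
    ∃ E : Set (OpenPartialHomeomorph Z Z), E.Finite ∧ (∀ g ∈ E, g.symm ∈ E) ∧
      (∀ g ∈ E, g ∈ H ∧ g.source ⊆ U ∧ g.target ⊆ U) ∧
      (∀ g ∈ H, g.source ⊆ U → g.target ⊆ U → Generated E g) ∧
      (∀ g ∈ E, ∃ g' ∈ H, closure g.source ⊆ g'.source ∧ EqOn g g' g.source)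

/-- Any transformation in `S` is the identity on its domain if it is the identity on some
non-empty open subset of its domain. -/
def QuasiEffectiveOn (S : Set (OpenPartialHomeomorph Z Z)) : Prop :=
  ∀ h ∈ S, ∀ O : Set Z, IsOpen O → O.Nonempty → O ⊆ h.source → (∀ x ∈ O, h x = x) →
    ∀ x ∈ h.source, h x = x

/-- `H` is quasi-effective. -/
def IsQuasiEffective (H : StructureGroupoid Z) : Prop :=
  ∃ S, IsGeneratingSystem H S ∧ QuasiEffectiveOn S

end Pseudogroups

/-! ### Covers by quasi-locally equal metric spaces, and strong equicontinuity -/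

/-- The set `U` is contained in `A`, and it is open for the metric `m` on `A`. -/
def IsOpenFor {Z : Type u} {A : Set Z} (m : MetricSpace A) (U : Set Z) : Prop :=
  U ⊆ A ∧ IsOpen[m.toUniformSpace.toTopologicalSpace] {x : A | (x : Z) ∈ U}

/-- A cover `{(Z_i, d_i)}` of the set `Z` by quasi-locally equal metric spaces.  The neighborhood
`U` in `compatible` does not depend on `ε`, and `δ` depends only on `ε`. -/
structure QuasiLocalCover (Z : Type u) where
  ι : Type u
  space : ι → Set Z
  metric : ∀ i, MetricSpace (space i)
  covers : ∀ z : Z, ∃ i, z ∈ space i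
  inter_open : ∀ i j,
    IsOpenFor (metric i) (space i ∩ space j) ∧ IsOpenFor (metric j) (space i ∩ space j)
  compatible : ∃ δ : ℝ → ℝ, (∀ ε > 0, 0 < δ ε) ∧
    ∀ i j, ∀ z ∈ space i ∩ space j, ∃ U : Set Z, z ∈ U ∧
      IsOpenFor (metric i) U ∧ IsOpenFor (metric j) U ∧
      ∀ ε > 0, ∀ x ∈ U, ∀ y ∈ U,
        ∀ (hx : x ∈ space i) (hy : y ∈ space i) (hx' : x ∈ space j) (hy' : y ∈ space j),
          (metric i).dist ⟨x, hx⟩ ⟨y, hy⟩ < δ ε → (metric j).dist ⟨x, hx'⟩ ⟨y, hy'⟩ < ε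

namespace QuasiLocalCover

variable {Z : Type u} (C : QuasiLocalCover Z)

/-- The open ball of `(Z_i, d_i)` of center `x` and radius `r`. -/
def ball (i : C.ι) (x : C.space i) (r : ℝ) : Set Z :=
  {y | ∃ hy : y ∈ C.space i, (C.metric i).dist ⟨y, hy⟩ x < r}

/-- The given topology of `Z` is the one that has the open balls of all the metric spaces
`(Z_i, d_i)` as a base. -/
def InducesTopology [TopologicalSpace Z] : Prop :=
  IsTopologicalBasis {B : Set Z | ∃ (i : C.ι) (x : C.space i) (r : ℝ), 0 < r ∧ B = C.ball i x r}

/-- The maps in `S` are uniformly equicontinuous with respect to the metrics of the cover. -/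
def Equicontinuous [TopologicalSpace Z] (S : Set (OpenPartialHomeomorph Z Z)) : Prop :=
  ∀ ε > (0 : ℝ), ∃ δ > (0 : ℝ), ∀ h ∈ S, ∀ i j : C.ι, ∀ x ∈ h.source, ∀ y ∈ h.source,
    ∀ (hx : x ∈ C.space i) (hy : y ∈ C.space i) (hx' : h x ∈ C.space j) (hy' : h y ∈ C.space j),
      (C.metric i).dist ⟨x, hx⟩ ⟨y, hy⟩ < δ → (C.metric j).dist ⟨h x, hx'⟩ ⟨h y, hy'⟩ < ε

end QuasiLocalCover

section Closure

variable {Z : Type u} [TopologicalSpace Z]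

/-- The condition of strong equicontinuity for the set `S`, with respect to some quasi-local
metric that induces the topology of `Z`. -/
def StronglyEquicontinuousOn (S : Set (OpenPartialHomeomorph Z Z)) : Prop :=
  ∃ C : QuasiLocalCover Z, C.InducesTopology ∧ C.Equicontinuous S

/-- `H` is strongly equicontinuous. -/
def IsStronglyEquicontinuous (H : StructureGroupoid Z) : Prop :=
  ∃ S, IsGeneratingSystem H S ∧ StronglyEquicontinuousOn S

/-- `S` is a symmetric set of generators of `H` that is closed under compositions and restrictions
to open sets, and satisfies the conditions of strong equicontinuity and quasi-effectiveness. -/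
structure IsAdmissible (H : StructureGroupoid Z) (S : Set (OpenPartialHomeomorph Z Z)) :
    Prop extends IsGeneratingSystem H S where
  restr : ∀ e ∈ S, ∀ s : Set Z, IsOpen s → e.restr s ∈ S
  stronglyEquicontinuous : StronglyEquicontinuousOn S
  quasiEffective : QuasiEffectiveOn S

variable (Z) in
/-- A continuous map from an open subset of `Z` to (an open subset of) `Z`. -/
structure LocalMap where
  dom : Opens Z
  map : C(dom, Z)

namespace LocalMap

/-- The restriction of `h` to an open subset of its domain, as a continuous map. -/
def resMap (h : LocalMap Z) (O : Opens Z) (hO : O ≤ h.dom) : C(O, Z) where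
  toFun y := h.map ⟨y, hO y.2⟩
  continuous_toFun := h.map.continuous.comp (continuous_subtype_val.subtype_mk _)

/-- The restriction of `h` to an open subset of its domain. -/
def restr (h : LocalMap Z) (O : Opens Z) (hO : O ≤ h.dom) : LocalMap Z :=
  ⟨O, h.resMap O hO⟩

/-- The composite `g ∘ f`, with maximal domain. -/
def comp (g f : LocalMap Z) : LocalMap Z where
  dom := ⟨{x | ∃ hx : x ∈ f.dom, f.map ⟨x, hx⟩ ∈ g.dom}, by
    have h : IsOpen (f.map ⁻¹' (g.dom : Set Z)) := g.dom.isOpen.preimage f.map.continuous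
    have h' := f.dom.isOpen.isOpenMap_subtype_val _ h
    convert h' using 1
    ext x
    simp⟩
  map :=
    { toFun := fun x => g.map ⟨f.map ⟨x, x.2.1⟩, x.2.2⟩
      continuous_toFun := g.map.continuous.comp
        ((f.map.continuous.comp (continuous_subtype_val.subtype_mk _)).subtype_mk _) }

/-- `h` is the combination of the family `𝒢`: the domain of `h` is the union of the domains
of the members of `𝒢`, which are restrictions of `h`. -/
def IsCombination (h : LocalMap Z) (𝒢 : Set (LocalMap Z)) : Prop :=
  (∀ g ∈ 𝒢, ∃ hg : g.dom ≤ h.dom, ∀ x : g.dom, g.map x = h.map ⟨x, hg x.2⟩) ∧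
    ∀ x ∈ h.dom, ∃ g ∈ 𝒢, x ∈ g.dom

/-- The local map underlying a homeomorphism between open sets. -/
def ofHomeo (e : OpenPartialHomeomorph Z Z) : LocalMap Z where
  dom := ⟨e.source, e.open_source⟩
  map := ⟨fun x => e x, e.continuousOn.domRestrict⟩

end LocalMap

/-- The set `C(O, Z) ∩ S` of the elements of `S` with domain `O`, in `C(O, Z)` (which Mathlib
endows with the compact-open topology). -/
def mapsWithDomain (S : Set (OpenPartialHomeomorph Z Z)) (O : Opens Z) : Set C(O, Z) :=
  {f | ∃ s ∈ S, s.source = (O : Set Z) ∧ ∀ x : O, f x = s x}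

/-- The set of maps between open subsets of `Z` that are, on some neighborhood of each
point, compact-open limits of elements of `S`. -/
def localClosure (S : Set (OpenPartialHomeomorph Z Z)) : Set (LocalMap Z) :=
  {h | ∀ x ∈ h.dom, ∃ (O : Opens Z) (hO : O ≤ h.dom), x ∈ O ∧
    h.resMap O hO ∈ closure (mapsWithDomain S O)}

/-- The maps in `localClosure S` that are homeomorphisms (between open sets). -/
def homeoClosure (S : Set (OpenPartialHomeomorph Z Z)) : Set (OpenPartialHomeomorph Z Z) :=
  {e | LocalMap.ofHomeo e ∈ localClosure S}

end Closure

end PseudogroupClosure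

namespace PseudogroupClosure

open Filter

/-! ### Germs of a pseudogroup and generating systems -/

section Germs

variable {Z : Type u} [TopologicalSpace Z] {H : StructureGroupoid Z}
  {E S T : Set (OpenPartialHomeomorph Z Z)} {e e' h : OpenPartialHomeomorph Z Z} {x : Z}

/-! Fix a metric compatible with the topology of `Z`. Everything rests on `HasUniformExtensions`: a
germ of `H` from a point near `p` to a point near `q` extends to an element of `S` on a ball about
`p` whose radius does not depend on the germ, with values near `q`. By compact generation
(`IsAdmissible.exists_extension`), a germ over `U` is a word in finitely many generators, each
having representatives of a definite size. The word is composed letter by letter. Since `S` is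
closed under composition, strong equicontinuity bounds the oscillation of all partial products at
once, so the domain never has to shrink, however long the word. Quasi-effectiveness makes the
extension unique: elements of `S` with a common germ agree wherever both are defined
(`IsAdmissible.eqOn_of_eventuallyEq`).

Extending inverse germs shows that limits of elements of `S` are injective
(`Approximable.eq_of_apply_eq`) and open (`Approximable.image_mem_nhds`), and that inverses of
limits are limits (`Approximable.symm`). Extending the germs themselves gives equicontinuous
families on a fixed compact neighborhood, so Arzelà–Ascoli produces a limit map sending `x` to any
prescribed point of the closure of its orbit. Strong equicontinuity survives limits by approximating
at two points at a time. Finally, `S ∩ T` is admissible when `S` and `T` are, and replacing germs by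
their extensions in `S ∩ T` shows that `S` and `T` have the same limits. -/

theorem symm_eventuallyEq (hx : x ∈ e.source) (hx' : x ∈ e'.source) (he : e =ᶠ[𝓝 x] e') :
    e.symm =ᶠ[𝓝 (e x)] e'.symm := by
  have h1 : Tendsto e.symm (𝓝 (e x)) (𝓝 x) := e.tendsto_symm hx
  filter_upwards [h1.eventually he, h1.eventually (e'.open_source.mem_nhds hx'),
    e.open_target.mem_nhds (e.map_source hx)] with z h2 h3 h4
  rw [e.right_inv h4] at h2
  rw [← e'.left_inv h3, ← h2]

theorem restr_eventuallyEq (s : Set Z) : e.restr s =ᶠ[𝓝 x] e :=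
  Eventually.of_forall fun _ => rfl

theorem mem_restr_source {s : Set Z} (hs : IsOpen s) :
    x ∈ (e.restr s).source ↔ x ∈ e.source ∧ x ∈ s := by
  rw [e.restr_source' s hs]; rfl

/-- Induction on the way a germ of an element of the pseudogroup generated by a symmetric set
decomposes as a product of germs of generators. -/
theorem Generated.germ_induction (hE : ∀ e ∈ E, e.symm ∈ E)
    {Q : OpenPartialHomeomorph Z Z → Z → Prop}
    (hbasic : ∀ e ∈ E, ∀ x ∈ e.source, Q e x)
    (hcomp : ∀ (e e' : OpenPartialHomeomorph Z Z) (x : Z), x ∈ e.source → e x ∈ e'.source → Q e x → Q e' (e x) → Q (e.trans e') x)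
    (hgerm : ∀ (e e' : OpenPartialHomeomorph Z Z) (x : Z), x ∈ e.source → x ∈ e'.source → e' =ᶠ[𝓝 x] e → Q e x → Q e' x)
    (hh : Generated E h) : ∀ x ∈ h.source, Q h x := by
  -- `Q` is not assumed stable under inversion, so the induction carries `h` and `h.symm` together;
  -- symmetry of `E` starts it.
  suffices H : (∀ x ∈ h.source, Q h x) ∧ ∀ x ∈ h.target, Q h.symm x from H.1
  induction hh with
  | basic e he => exact ⟨hbasic e he, hbasic e.symm (hE e he)⟩
  | comp e e' _ _ ih ih' =>
    refine ⟨fun x hx => ?_, fun x hx => ?_⟩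
    · rw [e.trans_source] at hx
      exact hcomp e e' x hx.1 hx.2 (ih.1 x hx.1) (ih'.1 _ hx.2)
    · rw [OpenPartialHomeomorph.trans_symm_eq_symm_trans_symm]
      rw [e.trans_target] at hx
      exact hcomp e'.symm e.symm x hx.1 hx.2 (ih'.2 x hx.1) (ih.2 _ hx.2)
  | inv e _ ih => exact ⟨ih.2, fun x hx => by simpa using ih.1 x hx⟩
  | restr e s hs _ ih =>
    have h1 : (e.restr s).source ⊆ e.source := fun x hx => ((mem_restr_source hs).1 hx).1
    refine ⟨fun x hx => hgerm e _ x (h1 hx) hx (restr_eventuallyEq s) (ih.1 x (h1 hx)), ?_⟩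
    intro x hx
    have h2 : (e.restr s).target ⊆ e.target := fun x hx => hx.1
    exact hgerm e.symm _ x (h2 hx) hx (Eventually.of_forall fun _ => rfl) (ih.2 x (h2 hx))
  | combination e s hs hx _ ih =>
    refine ⟨fun x hxe => ?_, fun y hy => ?_⟩
    · have h1 := (mem_restr_source (e := e) (hs x hxe)).2 ⟨hxe, hx x hxe⟩
      exact hgerm (e.restr (s x)) e x h1 hxe (restr_eventuallyEq _).symm ((ih x hxe).1 x h1)
    · have hxe := e.map_target hy
      have h1 := (mem_restr_source (e := e) (hs _ hxe)).2 ⟨hxe, hx _ hxe⟩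
      have h2 := (e.restr (s (e.symm y))).map_source h1
      have h3 : (e.restr (s (e.symm y))) (e.symm y) = y := e.right_inv hy
      rw [h3] at h2
      exact hgerm (e.restr (s (e.symm y))).symm e.symm y h2 hy
        (Eventually.of_forall fun _ => rfl) ((ih _ hxe).2 y h2)
  | congr e e' _ he ih =>
    refine ⟨fun x hx => ?_, fun x hx => ?_⟩
    · have h1 := hx
      rw [he.source_eq] at h1
      exact hgerm e e' x h1 hx (he.eqOn.eventuallyEq_of_mem (e'.open_source.mem_nhds hx))
        (ih.1 x h1)
    · have h1 := hx
      rw [he.target_eq] at h1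
      exact hgerm e.symm e'.symm x h1 hx
        ((OpenPartialHomeomorph.EqOnSource.symm' he).eqOn.eventuallyEq_of_mem
          (e'.open_target.mem_nhds hx)) (ih.2 x h1)

/-- Every element of `H` coincides near each point with some element of a set of generators that is
symmetric and closed under compositions. -/
theorem IsGeneratingSystem.exists_germ (hS : IsGeneratingSystem H S) (hh : h ∈ H)
    (hx : x ∈ h.source) : ∃ s ∈ S, x ∈ s.source ∧ s =ᶠ[𝓝 x] h := by
  refine (hS.generates h hh).germ_induction (Q := fun h x => ∃ s ∈ S, x ∈ s.source ∧ s =ᶠ[𝓝 x] h)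
    hS.symm (fun e he x hx => ⟨e, he, hx, EventuallyEq.rfl⟩) ?_ ?_ x hx
  · rintro e e' x hx hx' ⟨s, hs, hxs, hse⟩ ⟨s', hs', hxs', hse'⟩
    have h1 : s x = e x := hse.eq_of_nhds
    refine ⟨s.trans s', hS.comp s hs s' hs', ?_, ?_⟩
    · rw [s.trans_source]; exact ⟨hxs, by rw [mem_preimage, h1]; exact hxs'⟩
    · have h2 : Tendsto e (𝓝 x) (𝓝 (e x)) := e.continuousAt hx
      filter_upwards [hse, h2.eventually hse'] with z h3 h4
      simp [h3, h4]
  · rintro e e' x hx hx' hee ⟨s, hs, hxs, hse⟩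
    exact ⟨s, hs, hxs, hse.trans hee.symm⟩

/-- Near each point `h` equals a restriction of an element of `S`, and `h` is the combination of
these pieces. This reduces every generation claim to germs. -/
theorem Generated.of_exists_germ (hrestr : ∀ e ∈ S, ∀ s : Set Z, IsOpen s → e.restr s ∈ S)
    (hloc : ∀ x ∈ h.source, ∃ s ∈ S, x ∈ s.source ∧ s =ᶠ[𝓝 x] h) : Generated S h := by
  have key : ∀ x ∈ h.source, ∃ V : Set Z, IsOpen V ∧ x ∈ V ∧ Generated S (h.restr V) := by
    intro x hx
    obtain ⟨s, hs, hxs, hsh⟩ := hloc x hx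
    obtain ⟨W, hW, hWo, hxW⟩ := eventually_nhds_iff.1 hsh
    refine ⟨W ∩ s.source ∩ h.source, (hWo.inter s.open_source).inter h.open_source,
      ⟨⟨hxW, hxs⟩, hx⟩, ?_⟩
    have hV := (hWo.inter s.open_source).inter h.open_source
    refine Generated.congr _ _ (Generated.basic _ (hrestr s hs _ hV)) ?_
    refine ⟨?_, ?_⟩
    · rw [h.restr_source' _ hV, s.restr_source' _ hV]
      ext z; simp; tauto
    · intro z hz
      have := (mem_restr_source hV).1 hz
      exact (hW z this.2.1.1).symm
  choose! V hVo hxV hV using key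
  exact Generated.combination h V hVo hxV hV

/-- The set of all restrictions to open sets of the elements of `S`. -/
def restrictions (S : Set (OpenPartialHomeomorph Z Z)) : Set (OpenPartialHomeomorph Z Z) :=
  {e | ∃ s ∈ S, e.source ⊆ s.source ∧ EqOn e s e.source}

theorem mem_restrictions_of_subset {S : Set (OpenPartialHomeomorph Z Z)}
    (he : e ∈ restrictions S) (hs : e'.source ⊆ e.source) (heq : EqOn e' e e'.source) :
    e' ∈ restrictions S := by
  obtain ⟨s, hS, h1, h2⟩ := he
  exact ⟨s, hS, hs.trans h1, heq.trans (h2.mono hs)⟩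

theorem symm_mem_restrictions (hS : ∀ s ∈ S, s.symm ∈ S) (he : e ∈ restrictions S) :
    e.symm ∈ restrictions S := by
  obtain ⟨s, hs, h1, h2⟩ := he
  refine ⟨s.symm, hS s hs, fun y hy => ?_, fun y hy => ?_⟩
  · have hx := e.map_target hy
    have h3 := s.map_source (h1 hx)
    rwa [← h2 hx, e.right_inv hy] at h3
  · have hx := e.map_target hy
    have h3 := s.left_inv (h1 hx)
    rw [← h2 hx, e.right_inv hy] at h3
    exact h3.symm

theorem trans_mem_restrictions (hS : ∀ e ∈ S, ∀ e' ∈ S, e.trans e' ∈ S)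
    (he : e ∈ restrictions S) (he' : e' ∈ restrictions S) : e.trans e' ∈ restrictions S := by
  obtain ⟨s, hs, h1, h2⟩ := he
  obtain ⟨s', hs', h1', h2'⟩ := he'
  refine ⟨s.trans s', hS s hs s' hs', fun x hx => ?_, fun x hx => ?_⟩ <;>
  rw [e.trans_source] at hx
  · rw [s.trans_source]
    exact ⟨h1 hx.1, by rw [mem_preimage, ← h2 hx.1]; exact h1' hx.2⟩
  · simp only [OpenPartialHomeomorph.coe_trans, Function.comp_apply]
    rw [← h2 hx.1, h2' hx.2]

theorem restrictions_subset [ClosedUnderRestriction H] (hS : ∀ e ∈ S, e ∈ H)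
    (he : e ∈ restrictions S) : e ∈ H := by
  obtain ⟨s, hs, h1, h2⟩ := he
  refine H.mem_of_eqOnSource (closedUnderRestriction' (hS s hs) e.open_source) ?_
  refine ⟨?_, h2⟩
  rw [s.restr_source' _ e.open_source]
  exact (inter_eq_right.2 h1).symm

theorem restr_mem_restrictions (he : e ∈ restrictions S) (s : Set Z) :
    e.restr s ∈ restrictions S :=
  mem_restrictions_of_subset he (fun _ hx => hx.1) fun _ _ => rfl

theorem congr_mem_restrictions (he : e ∈ restrictions S) (h : e' ≈ e) : e' ∈ restrictions S :=
  mem_restrictions_of_subset he h.source_eq.subset h.eqOn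

/-- Two generating systems that are closed under restrictions have a common generating system. -/
theorem isGeneratingSystem_inter (hS : IsGeneratingSystem H S) (hT : IsGeneratingSystem H T)
    (hSr : ∀ e ∈ S, ∀ s : Set Z, IsOpen s → e.restr s ∈ S)
    (hTr : ∀ e ∈ T, ∀ s : Set Z, IsOpen s → e.restr s ∈ T) : IsGeneratingSystem H (S ∩ T) where
  subset e he := hS.subset e he.1
  symm e he := ⟨hS.symm e he.1, hT.symm e he.2⟩
  comp e he e' he' := ⟨hS.comp e he.1 e' he'.1, hT.comp e he.2 e' he'.2⟩
  congr e he e' h := ⟨hS.congr e he.1 e' h, hT.congr e he.2 e' h⟩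
  generates h hh := by
    refine Generated.of_exists_germ (fun e he s hs => ⟨hSr e he.1 s hs, hTr e he.2 s hs⟩) ?_
    intro x hx
    obtain ⟨s, hs, hxs, hsh⟩ := hS.exists_germ hh hx
    obtain ⟨t, ht, hxt, hth⟩ := hT.exists_germ hh hx
    obtain ⟨W, hW, hWo, hxW⟩ := eventually_nhds_iff.1 (hsh.trans hth.symm)
    have hV := (hWo.inter s.open_source).inter t.open_source
    refine ⟨s.restr (W ∩ s.source ∩ t.source), ⟨hSr s hs _ hV, ?_⟩,
      (mem_restr_source hV).2 ⟨hxs, ⟨hxW, hxs⟩, hxt⟩, (restr_eventuallyEq _).trans hsh⟩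
    refine hT.congr _ (hTr t ht _ hV) _ ⟨?_, ?_⟩
    · rw [s.restr_source' _ hV, t.restr_source' _ hV]
      ext z; simp; tauto
    · intro z hz
      exact hW z ((mem_restr_source hV).1 hz).2.1.1

theorem isGeneratingSystem_restrictions [ClosedUnderRestriction H] (hS : IsGeneratingSystem H S) :
    IsGeneratingSystem H (restrictions S) where
  subset _ he := restrictions_subset hS.subset he
  symm _ he := symm_mem_restrictions hS.symm he
  comp _ he _ he' := trans_mem_restrictions hS.comp he he'
  congr _ he _ h := congr_mem_restrictions he h
  generates h hh := by
    refine Generated.of_exists_germ (fun e he s _ => restr_mem_restrictions he s) ?_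
    intro x hx
    obtain ⟨s, hs, hxs, hsh⟩ := hS.exists_germ hh hx
    exact ⟨s, ⟨s, hs, Subset.rfl, fun _ _ => rfl⟩, hxs, hsh⟩

theorem QuasiEffectiveOn.restrictions (hS : QuasiEffectiveOn S) :
    QuasiEffectiveOn (restrictions S) := by
  rintro h ⟨s, hs, h1, h2⟩ O hO hne hOh hid x hx
  rw [h2 hx]
  exact hS s hs O hO hne (hOh.trans h1) (fun z hz => by rw [← h2 (hOh hz), hid z hz]) x (h1 hx)

theorem QuasiEffectiveOn.mono (hS : QuasiEffectiveOn S) (hTS : T ⊆ S) : QuasiEffectiveOn T :=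
  fun h hh => hS h (hTS hh)

theorem StronglyEquicontinuousOn.restrictions (hS : StronglyEquicontinuousOn S) :
    StronglyEquicontinuousOn (restrictions S) := by
  obtain ⟨C, hC, hS⟩ := hS
  refine ⟨C, hC, fun ε hε => ?_⟩
  obtain ⟨δ, hδ, h⟩ := hS ε hε
  refine ⟨δ, hδ, ?_⟩
  rintro e ⟨s, hs, h1, h2⟩ i j x hx y hy hxi hyi hxj hyj hd
  have := h s hs i j x (h1 hx) y (h1 hy) hxi hyi (by rwa [← h2 hx]) (by rwa [← h2 hy]) hd
  simpa only [h2 hx, h2 hy] using this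

theorem StronglyEquicontinuousOn.mono (hS : StronglyEquicontinuousOn S) (hTS : T ⊆ S) :
    StronglyEquicontinuousOn T := by
  obtain ⟨C, hC, hS⟩ := hS
  refine ⟨C, hC, fun ε hε => ?_⟩
  obtain ⟨δ, hδ, h⟩ := hS ε hε
  exact ⟨δ, hδ, fun e he => h e (hTS he)⟩

/-- The two hypotheses may be witnessed by different systems. Both conditions survive adding
restrictions and passing to subsets, and once the systems are closed under restrictions their
intersection still contains every germ of `H`. -/
theorem exists_isAdmissible [ClosedUnderRestriction H] (hqe : IsQuasiEffective H)
    (hse : IsStronglyEquicontinuous H) : ∃ S, IsAdmissible H S := by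
  obtain ⟨S, hS, hSq⟩ := hqe
  obtain ⟨T, hT, hTe⟩ := hse
  exact ⟨restrictions S ∩ restrictions T,
    { toIsGeneratingSystem := isGeneratingSystem_inter (isGeneratingSystem_restrictions hS)
        (isGeneratingSystem_restrictions hT) (fun e he s _ => restr_mem_restrictions he s)
        (fun e he s _ => restr_mem_restrictions he s)
      restr := fun e he s _ => ⟨restr_mem_restrictions he.1 s, restr_mem_restrictions he.2 s⟩
      stronglyEquicontinuous := hTe.restrictions.mono inter_subset_right
      quasiEffective := hSq.restrictions.mono inter_subset_left }⟩

theorem IsAdmissible.inter (hS : IsAdmissible H S) (hT : IsAdmissible H T) :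
    IsAdmissible H (S ∩ T) where
  toIsGeneratingSystem := isGeneratingSystem_inter hS.toIsGeneratingSystem
    hT.toIsGeneratingSystem hS.restr hT.restr
  restr e he s hs := ⟨hS.restr e he.1 s hs, hT.restr e he.2 s hs⟩
  stronglyEquicontinuous := hS.stronglyEquicontinuous.mono inter_subset_left
  quasiEffective := hS.quasiEffective.mono inter_subset_left

/-- Two elements of a quasi-effective set with a common germ agree wherever both are defined. -/
theorem IsAdmissible.eqOn_of_eventuallyEq (hS : IsAdmissible H S) (he : e ∈ S) (he' : e' ∈ S)
    (hx : x ∈ e.source) (hx' : x ∈ e'.source) (hee : e =ᶠ[𝓝 x] e') :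
    EqOn e e' (e.source ∩ e'.source) := by
  obtain ⟨W, hW, hWo, hxW⟩ := eventually_nhds_iff.1 hee
  have hV := (hWo.inter e.open_source).inter e'.open_source
  -- `e' ∘ e⁻¹` is the identity near `e x`, hence on its whole domain, which is the image under `e`
  -- of the common domain.
  have key := hS.quasiEffective (e.symm.trans e') (hS.comp _ (hS.symm e he) _ he')
    (e.symm.source ∩ e.symm ⁻¹' (W ∩ e.source ∩ e'.source))
    (e.symm.isOpen_inter_preimage hV)
    ⟨e x, e.map_source hx, by
      rw [mem_preimage, e.left_inv hx]; exact ⟨⟨hxW, hx⟩, hx'⟩⟩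
    (fun z hz => by rw [OpenPartialHomeomorph.trans_source]; exact ⟨hz.1, hz.2.2⟩)
    (fun z hz => by
      change e' (e.symm z) = z
      rw [← hW _ hz.2.1.1]
      exact e.right_inv hz.1)
  intro z hz
  have := key (e z) (by
    rw [OpenPartialHomeomorph.trans_source]
    exact ⟨e.map_source hz.1, by rw [mem_preimage, e.left_inv hz.1]; exact hz.2⟩)
  change e' (e.symm (e z)) = e z at this
  rw [e.left_inv hz.1] at this
  exact this.symm

end Germs

/-! ### Local comparison of the metrics of a cover with a metric of `Z` -/

/-- On the compact set of points of `K` where `ε ≤ b`, the function `a` attains its minimum, which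
is positive; this minimum is `δ`. It is used with two distance functions on a product. -/
theorem exists_lt_imp_lt_of_isCompact {W : Type*} [TopologicalSpace W] {K : Set W}
    (hK : IsCompact K) {a b : W → ℝ} (ha : Continuous a) (hb : Continuous b)
    (hab : ∀ p, a p ≤ 0 → b p ≤ 0) {ε : ℝ} (hε : 0 < ε) :
    ∃ δ > 0, ∀ p ∈ K, a p < δ → b p < ε := by
  have hc : IsCompact (K ∩ {p | ε ≤ b p}) := hK.inter_right (isClosed_le continuous_const hb)
  rcases (K ∩ {p | ε ≤ b p}).eq_empty_or_nonempty with h | h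
  · refine ⟨1, one_pos, fun p hp _ => ?_⟩
    by_contra hlt
    have : p ∈ K ∩ {p | ε ≤ b p} := ⟨hp, not_lt.1 hlt⟩
    simp [h] at this
  · obtain ⟨q, hq, hmin⟩ := hc.exists_isMinOn h ha.continuousOn
    refine ⟨a q, ?_, fun p hp hlt => ?_⟩
    · by_contra hle
      have h1 := hab q (not_lt.1 hle)
      have h2 : ε ≤ b q := hq.2
      linarith
    · by_contra hle
      have h1 : a q ≤ a p := hmin ⟨hp, not_lt.1 hle⟩
      linarith

namespace QuasiLocalCover

variable {Z : Type u} {C : QuasiLocalCover Z}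

theorem isOpen_space [TopologicalSpace Z] (hC : C.InducesTopology) (i : C.ι) :
    IsOpen (C.space i) := by
  refine isOpen_iff_forall_mem_open.2 fun x hx => ?_
  refine ⟨C.ball i ⟨x, hx⟩ 1, fun y hy => hy.1, hC.isOpen ⟨i, _, 1, one_pos, rfl⟩, hx, ?_⟩
  rw [(C.metric i).dist_self]
  exact one_pos

theorem eventually_dist_lt [TopologicalSpace Z] (hC : C.InducesTopology) (i : C.ι)
    (x : C.space i) {ε : ℝ} (hε : 0 < ε) : ∀ᶠ y in 𝓝 x, (C.metric i).dist y x < ε := by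
  have h1 : C.ball i x ε ∈ 𝓝 (x : Z) := (hC.isOpen ⟨i, x, ε, hε, rfl⟩).mem_nhds
    ⟨x.2, by rw [(C.metric i).dist_self]; exact hε⟩
  filter_upwards [continuous_subtype_val.continuousAt.eventually h1] with y hy
  exact hy.2

/-- The topology here is the one induced from `Z`; the balls of the cover being open in `Z` is what
makes it fine enough. -/
theorem continuous_dist [TopologicalSpace Z] (hC : C.InducesTopology) (i : C.ι) :
    Continuous fun p : C.space i × C.space i => (C.metric i).dist p.1 p.2 := by
  rw [continuous_iff_continuousAt]
  rintro ⟨a, b⟩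
  rw [Metric.continuousAt_iff', nhds_prod_eq]
  intro ε hε
  filter_upwards [(eventually_dist_lt hC i a (half_pos hε)).prod_mk
    (eventually_dist_lt hC i b (half_pos hε))] with p hp
  have t := (C.metric i).dist_triangle
  have c := (C.metric i).dist_comm
  have h1 := t p.1 a p.2
  have h2 := t a b p.2
  have h3 := t a p.1 b
  have h4 := t p.1 p.2 b
  have h5 := c p.1 a
  have h6 := c p.2 b
  rw [Real.dist_eq, abs_lt]
  constructor <;> linarith [hp.1, hp.2]

/-- Near each point, the given metric and some metric of the cover are uniformly equivalent. -/
theorem exists_nhds_uniform_equivalence [MetricSpace Z] [LocallyCompactSpace Z]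
    (hC : C.InducesTopology) (p : Z) : ∃ i, ∃ K ∈ 𝓝 p, K ⊆ C.space i ∧
      (∀ ε > 0, ∃ δ > 0, ∀ x ∈ K, ∀ y ∈ K, ∀ (hx : x ∈ C.space i) (hy : y ∈ C.space i),
        dist x y < δ → (C.metric i).dist ⟨x, hx⟩ ⟨y, hy⟩ < ε) ∧
      (∀ ε > 0, ∃ δ > 0, ∀ x ∈ K, ∀ y ∈ K, ∀ (hx : x ∈ C.space i) (hy : y ∈ C.space i),
        (C.metric i).dist ⟨x, hx⟩ ⟨y, hy⟩ < δ → dist x y < ε) := by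
  obtain ⟨i, hi⟩ := C.covers p
  obtain ⟨K, hKp, hKi, hK⟩ := local_compact_nhds ((isOpen_space hC i).mem_nhds hi)
  have hK' : IsCompact ((↑) ⁻¹' K : Set (C.space i)) := by
    rw [Subtype.isCompact_iff, Subtype.image_preimage_coe, inter_eq_right.2 hKi]
    exact hK
  have hd : Continuous fun p : C.space i × C.space i => dist (p.1 : Z) p.2 := by fun_prop
  refine ⟨i, K, hKp, hKi, fun ε hε => ?_, fun ε hε => ?_⟩
  · obtain ⟨δ, hδ, h⟩ := exists_lt_imp_lt_of_isCompact (hK'.prod hK') hd (continuous_dist hC i)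
      (fun p hp => by
        have : p.1 = p.2 := Subtype.ext (dist_le_zero.1 hp)
        rw [this, (C.metric i).dist_self]) hε
    exact ⟨δ, hδ, fun x hx y hy hxi hyi hlt => h (⟨x, hxi⟩, ⟨y, hyi⟩) ⟨hx, hy⟩ hlt⟩
  · obtain ⟨δ, hδ, h⟩ := exists_lt_imp_lt_of_isCompact (hK'.prod hK') (continuous_dist hC i) hd
      (fun p hp => by
        have : p.1 = p.2 := (@dist_le_zero _ (C.metric i) _ _).1 hp
        rw [this, dist_self]) hε
    exact ⟨δ, hδ, fun x hx y hy hxi hyi hlt => h (⟨x, hxi⟩, ⟨y, hyi⟩) ⟨hx, hy⟩ hlt⟩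

end QuasiLocalCover

/-! ### Extension of germs to balls of uniform size -/

section Extension

variable {Z : Type u} [MetricSpace Z] {H : StructureGroupoid Z}
  {S : Set (OpenPartialHomeomorph Z Z)}

/-- Over a compact set, a strongly equicontinuous set is equicontinuous for the given metric, as far
as points with close images are concerned. -/
theorem StronglyEquicontinuousOn.exists_dist_lt [LocallyCompactSpace Z]
    (hS : StronglyEquicontinuousOn S) {L : Set Z}
    (hL : IsCompact L) : ∃ r > 0, ∀ ε > 0, ∃ δ > 0, ∀ s ∈ S, ∀ x ∈ s.source, ∀ y ∈ s.source,
      x ∈ L → s x ∈ L → dist x y < δ → dist (s x) (s y) < r → dist (s x) (s y) < ε := by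
  obtain ⟨C, hC, hS⟩ := hS
  -- Both ends of `s` are recorded in the pair `(x, s x)`, so that the compactness argument runs on
  -- `L ×ˢ L`.
  suffices h : ∃ r > 0, ∀ ε > 0, ∃ δ > 0, ∀ s ∈ S, ∀ x ∈ s.source, ∀ y ∈ s.source,
      (x, s x) ∈ L ×ˢ L → dist x y < δ → dist (s x) (s y) < r → dist (s x) (s y) < ε by
    obtain ⟨r, hr, h⟩ := h
    refine ⟨r, hr, fun ε hε => ?_⟩
    obtain ⟨δ, hδ, h⟩ := h ε hε
    exact ⟨δ, hδ, fun s hs x hx y hy hxL hsL => h s hs x hx y hy ⟨hxL, hsL⟩⟩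
  refine (hL.prod hL).induction_on (p := fun A : Set (Z × Z) => ∃ r > 0, ∀ ε > 0, ∃ δ > 0, ∀ s ∈ S,
    ∀ x ∈ s.source, ∀ y ∈ s.source,
      (x, s x) ∈ A → dist x y < δ → dist (s x) (s y) < r → dist (s x) (s y) < ε) ?_ ?_ ?_ ?_
  · exact ⟨1, one_pos, fun ε _ => ⟨1, one_pos, fun _ _ _ _ _ _ h => h.elim⟩⟩
  · rintro A B hAB ⟨r, hr, h⟩
    refine ⟨r, hr, fun ε hε => ?_⟩
    obtain ⟨δ, hδ, h⟩ := h ε hε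
    exact ⟨δ, hδ, fun s hs x hx y hy hxA => h s hs x hx y hy (hAB hxA)⟩
  · rintro A B ⟨r, hr, h⟩ ⟨r', hr', h'⟩
    refine ⟨min r r', lt_min hr hr', fun ε hε => ?_⟩
    obtain ⟨δ, hδ, h⟩ := h ε hε
    obtain ⟨δ', hδ', h'⟩ := h' ε hε
    refine ⟨min δ δ', lt_min hδ hδ', fun s hs x hx y hy hxA h1 h2 => ?_⟩
    rw [lt_min_iff] at h1 h2
    rcases hxA with hxA | hxA
    · exact h s hs x hx y hy hxA h1.1 h2.1
    · exact h' s hs x hx y hy hxA h1.2 h2.2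
  · rintro ⟨p, q⟩ -
    obtain ⟨i, K, hKp, hKi, hK, -⟩ := QuasiLocalCover.exists_nhds_uniform_equivalence hC p
    obtain ⟨j, L, hLq, hLj, -, hL⟩ := QuasiLocalCover.exists_nhds_uniform_equivalence hC q
    obtain ⟨r, hr, hrK⟩ := Metric.mem_nhds_iff.1 hKp
    obtain ⟨r', hr', hrL⟩ := Metric.mem_nhds_iff.1 hLq
    -- Halved radii keep `y` and `s y` inside `K` and `L`. For `s y` this needs the a priori bound
    -- by `r' / 2`: otherwise `s y` could leave `C.space j`, where strong equicontinuity says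
    -- nothing.
    refine ⟨Metric.ball p (r / 2) ×ˢ Metric.ball q (r' / 2), mem_nhdsWithin_of_mem_nhds
      (prod_mem_nhds (Metric.ball_mem_nhds _ (half_pos hr))
        (Metric.ball_mem_nhds _ (half_pos hr'))), r' / 2, half_pos hr', fun ε hε => ?_⟩
    obtain ⟨ε', hε', h1⟩ := hL ε hε
    obtain ⟨δ', hδ', h2⟩ := hS ε' hε'
    obtain ⟨δ, hδ, h3⟩ := hK δ' hδ'
    refine ⟨min δ (r / 2), lt_min hδ (half_pos hr), ?_⟩
    rintro s hs x hx y hy ⟨hxp, hxq⟩ hxy hsxy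
    rw [lt_min_iff] at hxy
    simp only [Metric.mem_ball] at hxp hxq
    have t1 := dist_triangle y x p
    have t2 := dist_triangle (s y) (s x) q
    rw [dist_comm y x] at t1
    rw [dist_comm (s y) (s x)] at t2
    have hxK : x ∈ K := hrK (by rw [Metric.mem_ball]; linarith)
    have hyK : y ∈ K := hrK (by rw [Metric.mem_ball]; linarith)
    have hxL : s x ∈ L := hrL (by rw [Metric.mem_ball]; linarith)
    have hyL : s y ∈ L := hrL (by rw [Metric.mem_ball]; linarith)
    exact h1 _ hxL _ hyL (hLj hxL) (hLj hyL) (h2 s hs i j x hx y hy (hKi hxK) (hKi hyK)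
      (hLj hxL) (hLj hyL) (h3 x hxK y hyK _ _ hxy.1))

/-- An element of `H` has, near the points of a compact subset of its domain, representatives in `S`
on balls of a fixed radius, with small oscillation. -/
theorem IsGeneratingSystem.exists_germ_on_ball (hS : IsGeneratingSystem H S)
    {h : OpenPartialHomeomorph Z Z} (hh : h ∈ H) {K : Set Z} (hK : IsCompact K)
    (hKh : K ⊆ h.source) {ε : ℝ} (hε : 0 < ε) :
    ∃ r > 0, ∀ p ∈ K, ∃ s ∈ S, Metric.ball p r ⊆ s.source ∧ s =ᶠ[𝓝 p] h ∧
      ∀ z ∈ Metric.ball p r, dist (s z) (h p) < ε := by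
  refine hK.induction_on (p := fun A : Set Z => ∃ r > 0, ∀ p ∈ A, ∃ s ∈ S,
    Metric.ball p r ⊆ s.source ∧ s =ᶠ[𝓝 p] h ∧ ∀ z ∈ Metric.ball p r, dist (s z) (h p) < ε)
    ⟨1, one_pos, fun _ h => h.elim⟩ ?_ ?_ ?_
  · rintro A B hAB ⟨r, hr, h⟩
    exact ⟨r, hr, fun p hp => h p (hAB hp)⟩
  · rintro A B ⟨r, hr, h⟩ ⟨r', hr', h'⟩
    refine ⟨min r r', lt_min hr hr', fun p hp => ?_⟩
    have b1 : Metric.ball p (min r r') ⊆ Metric.ball p r := Metric.ball_subset_ball (min_le_left _ _)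
    have b2 : Metric.ball p (min r r') ⊆ Metric.ball p r' :=
      Metric.ball_subset_ball (min_le_right _ _)
    rcases hp with hp | hp
    · obtain ⟨s, hs, h1, h2, h3⟩ := h p hp
      exact ⟨s, hs, b1.trans h1, h2, fun z hz => h3 z (b1 hz)⟩
    · obtain ⟨s, hs, h1, h2, h3⟩ := h' p hp
      exact ⟨s, hs, b2.trans h1, h2, fun z hz => h3 z (b2 hz)⟩
  · intro p hp
    obtain ⟨s, hs, hps, hsh⟩ := hS.exists_germ hh (hKh hp)
    have hcont : ∀ᶠ z in 𝓝 p, dist (s z) (s p) < ε / 2 :=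
      (s.continuousAt hps).eventually (Metric.ball_mem_nhds _ (half_pos hε))
    obtain ⟨r, hr, hball⟩ := Metric.eventually_nhds_iff_ball.1
      (hcont.and ((s.open_source.eventually_mem hps).and
        hsh.eventually_nhds))
    refine ⟨Metric.ball p (r / 2), mem_nhdsWithin_of_mem_nhds (Metric.ball_mem_nhds _ (half_pos hr)),
      r / 2, half_pos hr, fun p' hp' => ?_⟩
    have hsub : Metric.ball p' (r / 2) ⊆ Metric.ball p r := by
      apply Metric.ball_subset_ball'
      rw [Metric.mem_ball] at hp'
      linarith
    have hp'' := hball p' (hsub (Metric.mem_ball_self (half_pos hr)))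
    have h2 : s =ᶠ[𝓝 p'] h := hp''.2.2
    refine ⟨s, hs, fun z hz => (hball z (hsub hz)).2.1, h2, fun z hz => ?_⟩
    have h1 := (hball z (hsub hz)).1
    have h3 : s p' = h p' := h2.eq_of_nhds
    rw [← h3]
    have := dist_triangle_right (s z) (s p') (s p)
    linarith [hp''.1]

/-- The germs of `H` from points near `p` to points near `q` have representatives in `S` that are
defined on a fixed ball with center `p` and have small oscillation. -/
def HasUniformExtensions (H : StructureGroupoid Z) (S : Set (OpenPartialHomeomorph Z Z)) : Prop :=
  ∀ p q : Z, ∀ ε > 0, ∃ ρ > 0, ∀ h ∈ H, ∀ x ∈ h.source, dist x p < ρ → dist (h x) q < ρ →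
    ∃ t ∈ S, Metric.ball p ρ ⊆ t.source ∧ t =ᶠ[𝓝 x] h ∧ ∀ z ∈ Metric.ball p ρ, dist (t z) q < ε

/-- A bootstrap along a word in `E`. If a partial product `f` has oscillation below `r₁` on the
ball, the next generator has a representative on the image of that ball, so the longer product is
defined on the same ball with oscillation below `r₀`. It lies in `S`, so equicontinuity over
`closure U` improves `r₀` back to `min ε r₁`. Hence `ρ` does not depend on the length of the word.
-/
theorem IsAdmissible.exists_extension [LocallyCompactSpace Z] [ClosedUnderRestriction H]
    (hS : IsAdmissible H S) {U : Set Z} (hU : IsOpen U) (hUc : IsCompact (closure U)) {E : Set (OpenPartialHomeomorph Z Z)}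
    (hEf : E.Finite) (hEs : ∀ g ∈ E, g.symm ∈ E)
    (hEU : ∀ g ∈ E, g ∈ H ∧ g.source ⊆ U ∧ g.target ⊆ U)
    (hEg : ∀ g ∈ H, g.source ⊆ U → g.target ⊆ U → Generated E g)
    (hEe : ∀ g ∈ E, ∃ g' ∈ H, closure g.source ⊆ g'.source ∧ EqOn g g' g.source)
    {ε : ℝ} (hε : 0 < ε) :
    ∃ ρ > 0, ∀ h ∈ H, ∀ x ∈ h.source, x ∈ U → h x ∈ U → ∃ t ∈ S, Metric.ball x ρ ⊆ t.source ∧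
      t =ᶠ[𝓝 x] h ∧ ∀ z ∈ Metric.ball x ρ, dist (t z) (h x) < ε := by
  obtain ⟨r₀, hr₀, hB⟩ := hS.stronglyEquicontinuous.exists_dist_lt hUc
  have hG : ∃ r > 0, ∀ g ∈ E, ∀ p ∈ g.source, ∃ s ∈ S, Metric.ball p r ⊆ s.source ∧
      s =ᶠ[𝓝 p] g ∧ ∀ z ∈ Metric.ball p r, dist (s z) (s p) < r₀ := by
    -- Working with all small `r` lets the finitely many generators be treated one by one. For each,
    -- its extension `g'` is defined on the compact closure of the source, which gives a uniform
    -- radius.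
    have : ∀ᶠ r in 𝓝[>] (0 : ℝ), ∀ g ∈ E, ∀ p ∈ g.source, ∃ s ∈ S, Metric.ball p r ⊆ s.source ∧
        s =ᶠ[𝓝 p] g ∧ ∀ z ∈ Metric.ball p r, dist (s z) (s p) < r₀ := by
      refine (eventually_all_finite hEf).2 fun g hg => ?_
      obtain ⟨g', hg'H, hg'c, hgg'⟩ := hEe g hg
      obtain ⟨r, hr, h⟩ := hS.toIsGeneratingSystem.exists_germ_on_ball hg'H
        (hUc.of_isClosed_subset isClosed_closure (closure_mono (hEU g hg).2.1)) hg'c hr₀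
      filter_upwards [Ioo_mem_nhdsGT hr] with r' hr' p hp
      obtain ⟨s, hs, h1, h2, h3⟩ := h p (subset_closure hp)
      have hb : Metric.ball p r' ⊆ Metric.ball p r := Metric.ball_subset_ball hr'.2.le
      refine ⟨s, hs, hb.trans h1, h2.trans (hgg'.eventuallyEq_of_mem
        (g.open_source.mem_nhds hp)).symm, fun z hz => ?_⟩
      rw [h2.eq_of_nhds]
      exact h3 z (hb hz)
    obtain ⟨r, h1, h2⟩ := (this.and self_mem_nhdsWithin).exists
    exact ⟨r, h2, h1⟩
  obtain ⟨r₁, hr₁, hG⟩ := hG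
  -- The identity need not belong to `S`; the words start from representatives in `S` of its germs.
  obtain ⟨r₂, hr₂, hId⟩ := hS.toIsGeneratingSystem.exists_germ_on_ball H.id_mem hUc
    (fun _ _ => mem_univ _) hr₀
  obtain ⟨δ, hδ, hB⟩ := hB (min ε r₁) (lt_min hε hr₁)
  have hρ : 0 < min δ r₂ := lt_min hδ hr₂
  set ρ := min δ r₂
  let Good : OpenPartialHomeomorph Z Z → Z → Prop := fun f x => f ∈ S ∧
    Metric.ball x ρ ⊆ f.source ∧ f x ∈ U ∧ ∀ z ∈ Metric.ball x ρ, dist (f z) (f x) < min ε r₁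
  have good_of : ∀ f ∈ S, ∀ x ∈ U, Metric.ball x ρ ⊆ f.source → f x ∈ U →
      (∀ z ∈ Metric.ball x ρ, dist (f z) (f x) < r₀) → Good f x := by
    intro f hf x hx hb hfx h
    refine ⟨hf, hb, hfx, fun z hz => ?_⟩
    rw [dist_comm]
    refine hB f hf x (hb (Metric.mem_ball_self hρ)) z (hb hz) (subset_closure hx)
      (subset_closure hfx) ?_ ?_
    · rw [dist_comm]; exact lt_of_lt_of_le hz (min_le_left _ _)
    · rw [dist_comm]; exact h z hz
  have key : ∀ h, Generated E h → ∀ x ∈ h.source, h x ∈ U ∧ ∀ x₀ ∈ U, ∀ f, Good f x₀ → f x₀ = x →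
      ∃ f', Good f' x₀ ∧ f' =ᶠ[𝓝 x₀] h ∘ f := by
    intro h hh
    refine hh.germ_induction (Q := fun h x => h x ∈ U ∧ ∀ x₀ ∈ U, ∀ f, Good f x₀ → f x₀ = x →
      ∃ f', Good f' x₀ ∧ f' =ᶠ[𝓝 x₀] h ∘ f) hEs ?_ ?_ ?_
    · intro g hg x hx
      have hgx : g x ∈ U := (hEU g hg).2.2 (g.map_source hx)
      refine ⟨hgx, fun x₀ hx₀ f hf hfx => ?_⟩
      obtain ⟨s, hs, h1, h2, h3⟩ := hG g hg x hx
      have hsx : s x = g x := h2.eq_of_nhds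
      have hfb : ∀ z ∈ Metric.ball x₀ ρ, f z ∈ Metric.ball x r₁ := fun z hz => by
        rw [← hfx]; exact lt_of_lt_of_le (hf.2.2.2 z hz) (min_le_right _ _)
      refine ⟨f.trans s, good_of _ (hS.comp f hf.1 s hs) x₀ hx₀ ?_ ?_ ?_, ?_⟩
      · intro z hz
        rw [f.trans_source]
        exact ⟨hf.2.1 hz, h1 (hfb z hz)⟩
      · simp only [OpenPartialHomeomorph.coe_trans, Function.comp_apply, hfx, hsx]
        exact hgx
      · intro z hz
        simp only [OpenPartialHomeomorph.coe_trans, Function.comp_apply, hfx]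
        exact h3 _ (hfb z hz)
      · have hc : Tendsto f (𝓝 x₀) (𝓝 x) := by
          rw [← hfx]; exact f.continuousAt (hf.2.1 (Metric.mem_ball_self hρ))
        filter_upwards [hc.eventually h2] with z hz
        exact hz
    · rintro e e' x hx hx' ⟨h1, h2⟩ ⟨h1', h2'⟩
      refine ⟨h1', fun x₀ hx₀ f hf hfx => ?_⟩
      obtain ⟨f₁, hf₁, hf₁e⟩ := h2 x₀ hx₀ f hf hfx
      obtain ⟨f₂, hf₂, hf₂e⟩ := h2' x₀ hx₀ f₁ hf₁ (by
        rw [hf₁e.eq_of_nhds, Function.comp_apply, hfx])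
      refine ⟨f₂, hf₂, hf₂e.trans ?_⟩
      filter_upwards [hf₁e] with z hz
      simp only [OpenPartialHomeomorph.coe_trans, Function.comp_apply] at hz ⊢
      rw [hz]
    · rintro e e' x hx hx' hee ⟨h1, h2⟩
      refine ⟨by rwa [hee.eq_of_nhds], fun x₀ hx₀ f hf hfx => ?_⟩
      obtain ⟨f', hf', hfe⟩ := h2 x₀ hx₀ f hf hfx
      refine ⟨f', hf', hfe.trans ?_⟩
      have hc : Tendsto f (𝓝 x₀) (𝓝 x) := by
        rw [← hfx]; exact f.continuousAt (hf.2.1 (Metric.mem_ball_self hρ))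
      filter_upwards [hc.eventually hee] with z hz
      exact hz.symm
  refine ⟨ρ, hρ, fun h hh x hx hxU hhx => ?_⟩
  obtain ⟨s, hs, h1, h2, h3⟩ := hId x (subset_closure hxU)
  have hsx : s x = x := h2.eq_of_nhds
  have hb : Metric.ball x ρ ⊆ Metric.ball x r₂ := Metric.ball_subset_ball (min_le_right _ _)
  have hsGood : Good s x := good_of s hs x hxU (hb.trans h1) (by rwa [hsx]) fun z hz => by
    rw [hsx]; exact h3 z (hb hz)
  -- Only the restriction of `h` with source and target in `U` is a product of generators; it has
  -- the same germ at `x`.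
  have hV : IsOpen (h.source ∩ h ⁻¹' U ∩ U) := (h.isOpen_inter_preimage hU).inter hU
  have hxV : x ∈ (h.restr (h.source ∩ h ⁻¹' U ∩ U)).source :=
    (mem_restr_source hV).2 ⟨hx, ⟨hx, hhx⟩, hxU⟩
  have hgen : Generated E (h.restr (h.source ∩ h ⁻¹' U ∩ U)) := by
    refine hEg _ (closedUnderRestriction' hh hV) (fun z hz => ((mem_restr_source hV).1 hz).2.2) ?_
    intro y hy
    have h4 := (h.restr (h.source ∩ h ⁻¹' U ∩ U)).map_target hy
    have h5 := ((mem_restr_source hV).1 h4).2.1.2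
    have h6 := (h.restr (h.source ∩ h ⁻¹' U ∩ U)).right_inv hy
    rw [← h6]
    exact h5
  obtain ⟨t, ht, hte⟩ := (key _ hgen x hxV).2 x hxU s hsGood hsx
  have hth : t =ᶠ[𝓝 x] h := by
    filter_upwards [hte, h2] with z hz hz'
    rw [hz, Function.comp_apply, hz']
    rfl
  refine ⟨t, ht.1, ht.2.1, hth, fun z hz => ?_⟩
  rw [← hth.eq_of_nhds]
  exact lt_of_lt_of_le (ht.2.2.2 z hz) (min_le_left _ _)

/-- Since `U` meets every orbit, some `φ` and `ψ` in `S` carry `p` and `q` into `U`. The germ of `ψ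
∘ h ∘ φ⁻¹` is extended there and the result is conjugated back. -/
theorem IsAdmissible.hasUniformExtensions [LocallyCompactSpace Z] [ClosedUnderRestriction H]
    (hS : IsAdmissible H S) (hcg : IsCompactlyGenerated H) : HasUniformExtensions H S := by
  obtain ⟨U, hU, hUc, hUo, E, hEf, hEs, hEU, hEg, hEe⟩ := hcg
  have toU : ∀ p : Z, ∃ φ ∈ S, p ∈ φ.source ∧ φ p ∈ U := by
    intro p
    obtain ⟨y, ⟨h, hh, hp, rfl⟩, hy⟩ := hUo p
    obtain ⟨s, hs, hps, hsh⟩ := hS.toIsGeneratingSystem.exists_germ hh hp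
    exact ⟨s, hs, hps, by rwa [hsh.eq_of_nhds]⟩
  intro p q ε hε
  obtain ⟨φ, hφ, hpφ, hφU⟩ := toU p
  obtain ⟨ψ, hψ, hqψ, hψU⟩ := toU q
  have e1 : ∀ᶠ y in 𝓝 (ψ q), y ∈ ψ.target ∧ dist (ψ.symm y) q < ε :=
    (ψ.open_target.eventually_mem (ψ.map_source hqψ)).and
      ((ψ.tendsto_symm hqψ).eventually (Metric.ball_mem_nhds q hε))
  obtain ⟨ε', hε', he'⟩ := Metric.eventually_nhds_iff_ball.1 e1
  obtain ⟨ρ', hρ', hext⟩ := hS.exists_extension hU hUc hEf hEs hEU hEg hEe (half_pos hε')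
  have e2 : ∀ᶠ z in 𝓝 p, z ∈ φ.source ∧ φ z ∈ U ∧ dist (φ z) (φ p) < ρ' / 2 :=
    (φ.open_source.eventually_mem hpφ).and
      (((φ.continuousAt hpφ).eventually (hU.mem_nhds hφU)).and
        ((φ.continuousAt hpφ).eventually (Metric.ball_mem_nhds _ (half_pos hρ'))))
  have e3 : ∀ᶠ z in 𝓝 q, z ∈ ψ.source ∧ ψ z ∈ U ∧ dist (ψ z) (ψ q) < ε' / 2 :=
    (ψ.open_source.eventually_mem hqψ).and
      (((ψ.continuousAt hqψ).eventually (hU.mem_nhds hψU)).and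
        ((ψ.continuousAt hqψ).eventually (Metric.ball_mem_nhds _ (half_pos hε'))))
  obtain ⟨ρ₁, hρ₁, hp⟩ := Metric.eventually_nhds_iff_ball.1 e2
  obtain ⟨ρ₂, hρ₂, hq⟩ := Metric.eventually_nhds_iff_ball.1 e3
  refine ⟨min ρ₁ ρ₂, lt_min hρ₁ hρ₂, fun h hh x hx hxp hxq => ?_⟩
  have hb : Metric.ball p (min ρ₁ ρ₂) ⊆ Metric.ball p ρ₁ :=
    Metric.ball_subset_ball (min_le_left _ _)
  obtain ⟨hx1, hx2, hx3⟩ := hp x (lt_of_lt_of_le hxp (min_le_left _ _))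
  obtain ⟨hy1, hy2, hy3⟩ := hq (h x) (lt_of_lt_of_le hxq (min_le_right _ _))
  have hφH := hS.subset φ hφ
  have hψH := hS.subset ψ hψ
  have hcoe : ((φ.symm.trans h).trans ψ) (φ x) = ψ (h x) := by
    simp [φ.left_inv hx1]
  obtain ⟨t, ht, ht1, ht2, ht3⟩ := hext ((φ.symm.trans h).trans ψ)
    (H.trans (H.trans (H.symm hφH) hh) hψH) (φ x) (by
      simp only [OpenPartialHomeomorph.trans_source, OpenPartialHomeomorph.symm_source, mem_inter_iff,
        mem_preimage, OpenPartialHomeomorph.coe_trans, Function.comp_apply, φ.left_inv hx1]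
      exact ⟨⟨φ.map_source hx1, hx⟩, hy1⟩) hx2 (by rw [hcoe]; exact hy2)
  rw [hcoe] at ht3
  have hball : ∀ z ∈ Metric.ball p ρ₁, z ∈ φ.source ∧ φ z ∈ Metric.ball (φ x) ρ' ∧
      t (φ z) ∈ Metric.ball (ψ q) ε' := by
    intro z hz
    obtain ⟨hz1, -, hz3⟩ := hp z hz
    have h4 : φ z ∈ Metric.ball (φ x) ρ' := by
      rw [Metric.mem_ball]
      have := dist_triangle_right (φ z) (φ x) (φ p)
      linarith
    refine ⟨hz1, h4, ?_⟩
    have h5 := ht3 _ h4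
    have := dist_triangle (t (φ z)) (ψ (h x)) (ψ q)
    rw [Metric.mem_ball]
    linarith
  refine ⟨(φ.trans t).trans ψ.symm, hS.comp _ (hS.comp _ hφ _ ht) _ (hS.symm _ hψ), ?_, ?_, ?_⟩
  · intro z hz
    obtain ⟨h1, h2, h3⟩ := hball z (hb hz)
    simp only [OpenPartialHomeomorph.trans_source, OpenPartialHomeomorph.symm_source, mem_inter_iff,
      mem_preimage, OpenPartialHomeomorph.coe_trans, Function.comp_apply]
    exact ⟨⟨h1, ht1 h2⟩, (he' _ h3).1⟩
  · have c1 : Tendsto φ (𝓝 x) (𝓝 (φ x)) := φ.continuousAt hx1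
    have c2 : Tendsto h (𝓝 x) (𝓝 (h x)) := h.continuousAt hx
    filter_upwards [c1.eventually ht2, φ.open_source.mem_nhds hx1,
      c2.eventually (ψ.open_source.mem_nhds hy1)] with z h1 h2 h3
    simp only [OpenPartialHomeomorph.coe_trans, Function.comp_apply] at h1 ⊢
    rw [h1, φ.left_inv h2, ψ.left_inv h3]
  · intro z hz
    exact (he' _ (hball z (hb hz)).2.2).2

end Extension

/-! ### Uniform limits of elements of `S` on compact sets -/

section Approximation

variable {Z : Type u} [MetricSpace Z] {H : StructureGroupoid Z}
  {S T : Set (OpenPartialHomeomorph Z Z)} {f g : Z → Z} {K L P : Set Z}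

/-- The map `f` is a uniform limit on `K` of elements of `S`. -/
def Approximable (S : Set (OpenPartialHomeomorph Z Z)) (f : Z → Z) (K : Set Z) : Prop :=
  ∀ ε > 0, ∃ s ∈ S, K ⊆ s.source ∧ ∀ z ∈ K, dist (s z) (f z) < ε

theorem Approximable.mono (hf : Approximable S f K) (hLK : L ⊆ K) : Approximable S f L := by
  intro ε hε
  obtain ⟨s, hs, h1, h2⟩ := hf ε hε
  exact ⟨s, hs, hLK.trans h1, fun z hz => h2 z (hLK hz)⟩

theorem Approximable.congr (hf : Approximable S f K) (hfg : EqOn f g K) : Approximable S g K := by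
  intro ε hε
  obtain ⟨s, hs, h1, h2⟩ := hf ε hε
  exact ⟨s, hs, h1, fun z hz => by rw [← hfg hz]; exact h2 z hz⟩

theorem approximable_of_mem {s : OpenPartialHomeomorph Z Z} (hs : s ∈ S) (hK : K ⊆ s.source) :
    Approximable S s K :=
  fun ε hε => ⟨s, hs, hK, fun z _ => by rwa [dist_self]⟩

/-- The interior of `P` leaves room for approximants of `f` to send `K` into `P` too; uniform
continuity of `g` on `P` then controls the error. -/
theorem Approximable.comp (hS : ∀ e ∈ S, ∀ e' ∈ S, e.trans e' ∈ S) (hK : IsCompact K)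
    (hP : IsCompact P) (hf : Approximable S f K) (hfc : ContinuousOn f K)
    (hg : Approximable S g P) (hgc : ContinuousOn g P) (hfK : f '' K ⊆ interior P) :
    Approximable S (g ∘ f) K := by
  intro ε hε
  obtain ⟨r, hr, hrP⟩ := (hK.image_of_continuousOn hfc).exists_thickening_subset_open
    isOpen_interior hfK
  obtain ⟨t, ht, hPt, htg⟩ := hg (ε / 2) (half_pos hε)
  obtain ⟨η, hη, hgη⟩ := Metric.uniformContinuousOn_iff.1
    (hP.uniformContinuousOn_of_continuous hgc) (ε / 2) (half_pos hε)
  obtain ⟨s, hs, hKs, hsf⟩ := hf (min r η) (lt_min hr hη)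
  have hsP : ∀ z ∈ K, s z ∈ P := fun z hz => interior_subset (hrP
    (Metric.mem_thickening_iff.2 ⟨f z, mem_image_of_mem f hz,
      lt_of_lt_of_le (hsf z hz) (min_le_left _ _)⟩))
  refine ⟨s.trans t, hS s hs t ht, fun z hz => ?_, fun z hz => ?_⟩
  · rw [s.trans_source]
    exact ⟨hKs hz, hPt (hsP z hz)⟩
  · have h1 := htg _ (hsP z hz)
    have h2 := hgη _ (hsP z hz) _ (interior_subset (hfK (mem_image_of_mem f hz)))
      (lt_of_lt_of_le (hsf z hz) (min_le_right _ _))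
    have h3 := dist_triangle (t (s z)) (g (s z)) (g (f z))
    simp only [OpenPartialHomeomorph.coe_trans, Function.comp_apply]
    linarith

/-- If `s` sends `a` and `b` close to the same point, the germ of `s⁻¹` at `s a` extends over `s b`
with values near `a`. By uniqueness the extension agrees with `s⁻¹` at `s b`, so `b` is near `a`. -/
theorem Approximable.eq_of_apply_eq (hS : IsAdmissible H S) (hX : HasUniformExtensions H S)
    {a b : Z} (hf : Approximable S f {a, b}) (hab : f a = f b) : a = b := by
  by_contra hne
  obtain ⟨ρ, hρ, hext⟩ := hX (f a) a (dist a b / 2) (half_pos (dist_pos.2 hne))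
  obtain ⟨s, hs, hsub, hsf⟩ := hf ρ hρ
  have ha : a ∈ s.source := hsub (by simp)
  have hb : b ∈ s.source := hsub (by simp)
  have hsa := hsf a (by simp)
  have hsb := hsf b (by simp)
  rw [← hab] at hsb
  obtain ⟨t, ht, ht1, ht2, ht3⟩ := hext s.symm (H.symm (hS.subset s hs)) (s a) (s.map_source ha)
    hsa (by rw [s.left_inv ha, dist_self]; exact hρ)
  have h1 := hS.eqOn_of_eventuallyEq ht (hS.symm s hs) (ht1 hsa) (s.map_source ha) ht2
    ⟨ht1 hsb, s.map_source hb⟩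
  have h2 := ht3 _ hsb
  rw [h1, s.left_inv hb, dist_comm] at h2
  linarith [dist_pos.2 hne]

/-- The images of a neighborhood of `x` by the elements of `S` that send `x` close to `y` contain a
fixed ball. -/
theorem IsAdmissible.exists_ball_subset_image (hS : IsAdmissible H S)
    (hX : HasUniformExtensions H S) {x : Z} (hK : K ∈ 𝓝 x) (y : Z) :
    ∃ ρ > 0, ∀ s ∈ S, K ⊆ s.source → dist (s x) y < ρ → Metric.ball y ρ ⊆ s '' K := by
  obtain ⟨ε, hε, hεK⟩ := Metric.mem_nhds_iff.1 hK
  obtain ⟨ρ, hρ, hext⟩ := hX y x ε hε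
  refine ⟨ρ, hρ, fun s hs hKs hsx w hw => ?_⟩
  have hx : x ∈ s.source := hKs (mem_of_mem_nhds hK)
  obtain ⟨t, ht, ht1, ht2, ht3⟩ := hext s.symm (H.symm (hS.subset s hs)) (s x) (s.map_source hx)
    hsx (by rw [s.left_inv hx, dist_self]; exact hρ)
  have h1 := symm_eventuallyEq (ht1 hsx) (s.map_source hx) ht2
  have h2 : t (s x) = x := by rw [ht2.eq_of_nhds, s.left_inv hx]
  have h3 := t.map_source (ht1 hsx)
  rw [h2] at h1 h3
  have htw : t w ∈ K := hεK (ht3 w hw)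
  -- `t` extends the germ of `s⁻¹` with values in `K`, so `t⁻¹` agrees with `s` and `t w` is the
  -- required preimage.
  have h4 : t.symm (t w) = s (t w) := hS.eqOn_of_eventuallyEq (hS.symm t ht) hs h3 hx h1
    ⟨t.map_source (ht1 hw), hKs htw⟩
  exact ⟨t w, htw, by rw [← h4, t.left_inv (ht1 hw)]⟩

/-- The images of `K` under all good approximants contain one fixed ball, so that ball lies in the
closure of `f '' K`, which is compact and hence closed. -/
theorem Approximable.image_mem_nhds (hS : IsAdmissible H S) (hX : HasUniformExtensions H S)
    {x : Z} (hf : Approximable S f K) (hK : IsCompact K) (hKx : K ∈ 𝓝 x)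
    (hfc : ContinuousOn f K) : f '' K ∈ 𝓝 (f x) := by
  obtain ⟨ρ, hρ, h⟩ := hS.exists_ball_subset_image hX hKx (f x)
  refine Metric.mem_nhds_iff.2 ⟨ρ, hρ, fun w hw => ?_⟩
  rw [← (hK.image_of_continuousOn hfc).isClosed.closure_eq, Metric.mem_closure_iff]
  intro ε hε
  obtain ⟨s, hs, hKs, hsf⟩ := hf (min ρ ε) (lt_min hρ hε)
  obtain ⟨z, hz, rfl⟩ := h s hs hKs
    (lt_of_lt_of_le (hsf x (mem_of_mem_nhds hKx)) (min_le_left _ _)) hw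
  exact ⟨f z, mem_image_of_mem f hz, lt_of_lt_of_le (hsf z hz) (min_le_right _ _)⟩

/-- By compactness of `L`, every `s` in `S` close enough to `e` on `K` covers `L` by `s '' K`, so
`s⁻¹` is defined on `L`. Its distance to `e⁻¹` is controlled by uniform continuity of `e⁻¹` on `e ''
K`. -/
theorem Approximable.symm (hS : IsAdmissible H S) (hX : HasUniformExtensions H S)
    {e : OpenPartialHomeomorph Z Z} (he : Approximable S e K) (hK : IsCompact K)
    (hKe : K ⊆ e.source) (hL : IsCompact L) (hLK : L ⊆ e '' interior K) :
    Approximable S e.symm L := by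
  have hη : ∃ η > 0, ∀ s ∈ S, K ⊆ s.source → (∀ z ∈ K, dist (s z) (e z) < η) → L ⊆ s '' K := by
    refine hL.induction_on (p := fun A => ∃ η > 0, ∀ s ∈ S, K ⊆ s.source →
      (∀ z ∈ K, dist (s z) (e z) < η) → A ⊆ s '' K)
      ⟨1, one_pos, fun _ _ _ _ => empty_subset _⟩ ?_ ?_ ?_
    · rintro A B hAB ⟨η, hη, h⟩
      exact ⟨η, hη, fun s hs hKs hse => hAB.trans (h s hs hKs hse)⟩
    · rintro A B ⟨η, hη, h⟩ ⟨η', hη', h'⟩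
      refine ⟨min η η', lt_min hη hη', fun s hs hKs hse => union_subset ?_ ?_⟩
      · exact h s hs hKs fun z hz => lt_of_lt_of_le (hse z hz) (min_le_left _ _)
      · exact h' s hs hKs fun z hz => lt_of_lt_of_le (hse z hz) (min_le_right _ _)
    · intro w hw
      obtain ⟨x, hx, rfl⟩ := hLK hw
      obtain ⟨ρ, hρ, h⟩ := hS.exists_ball_subset_image hX (mem_interior_iff_mem_nhds.1 hx) (e x)
      exact ⟨Metric.ball (e x) ρ, mem_nhdsWithin_of_mem_nhds (Metric.ball_mem_nhds _ hρ), ρ, hρ,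
        fun s hs hKs hse => h s hs hKs (hse x (interior_subset hx))⟩
  obtain ⟨η, hη, h⟩ := hη
  intro ε hε
  have hcont : ContinuousOn e.symm (e '' K) := e.symm.continuousOn.mono fun w hw => by
    obtain ⟨z, hz, rfl⟩ := hw
    exact e.map_source (hKe hz)
  obtain ⟨η', hη', h'⟩ := Metric.uniformContinuousOn_iff.1
    ((hK.image_of_continuousOn (e.continuousOn.mono hKe)).uniformContinuousOn_of_continuous hcont)
    ε hε
  obtain ⟨s, hs, hKs, hse⟩ := he (min η η') (lt_min hη hη')
  have hLs := h s hs hKs fun z hz => lt_of_lt_of_le (hse z hz) (min_le_left _ _)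
  refine ⟨s.symm, hS.symm s hs, fun w hw => ?_, fun w hw => ?_⟩
  · obtain ⟨z, hz, rfl⟩ := hLs hw
    exact s.map_source (hKs hz)
  · have hwK : w ∈ e '' K := image_mono interior_subset (hLK hw)
    obtain ⟨z, hz, rfl⟩ := hLs hw
    have h1 := h' (e z) (mem_image_of_mem e hz) (s z) hwK (by
      rw [dist_comm]; exact lt_of_lt_of_le (hse z hz) (min_le_right _ _))
    rw [e.left_inv (hKe hz)] at h1
    rwa [s.left_inv (hKs hz)]

/-- The elements of `S` that send `a` into a compact set are equicontinuous at `a`. -/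
theorem IsAdmissible.exists_dist_lt_of_apply_mem (hS : IsAdmissible H S)
    (hX : HasUniformExtensions H S) {M : Set Z} (hM : IsCompact M) (a : Z) {ε : ℝ} (hε : 0 < ε) :
    ∃ δ > 0, ∀ s ∈ S, a ∈ s.source → s a ∈ M → ∀ z ∈ s.source, dist z a < δ →
      dist (s z) (s a) < ε := by
  refine hM.induction_on (p := fun A => ∃ δ > 0, ∀ s ∈ S, a ∈ s.source → s a ∈ A →
    ∀ z ∈ s.source, dist z a < δ → dist (s z) (s a) < ε)
    ⟨1, one_pos, fun _ _ _ h => h.elim⟩ ?_ ?_ ?_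
  · rintro A B hAB ⟨δ, hδ, h⟩
    exact ⟨δ, hδ, fun s hs ha hsa => h s hs ha (hAB hsa)⟩
  · rintro A B ⟨δ, hδ, h⟩ ⟨δ', hδ', h'⟩
    refine ⟨min δ δ', lt_min hδ hδ', fun s hs ha hsa z hz hd => ?_⟩
    rw [lt_min_iff] at hd
    rcases hsa with hsa | hsa
    · exact h s hs ha hsa z hz hd.1
    · exact h' s hs ha hsa z hz hd.2
  · intro b _
    obtain ⟨ρ, hρ, hext⟩ := hX a b (ε / 2) (half_pos hε)
    refine ⟨Metric.ball b ρ, mem_nhdsWithin_of_mem_nhds (Metric.ball_mem_nhds _ hρ), ρ, hρ,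
      fun s hs ha hsa z hz hd => ?_⟩
    obtain ⟨t, ht, ht1, ht2, ht3⟩ := hext s (hS.subset s hs) a ha (by rwa [dist_self]) hsa
    have haρ := Metric.mem_ball_self (x := a) hρ
    have h1 := hS.eqOn_of_eventuallyEq ht hs (ht1 haρ) ha ht2
    rw [← h1 ⟨ht1 hd, hz⟩, ← h1 ⟨ht1 haρ, ha⟩]
    have := dist_triangle_right (t z) (t a) b
    linarith [ht3 z hd, ht3 a haρ]

/-- Uniform limits on small compact sets do not depend on the choice of `S`. -/
theorem Approximable.exists_nhds_of_isAdmissible [LocallyCompactSpace Z] (hS : IsAdmissible H S)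
    (hX : HasUniformExtensions H (S ∩ T)) {x : Z} (hf : Approximable S f K) (hKx : K ∈ 𝓝 x) :
    ∃ L ∈ 𝓝 x, IsCompact L ∧ L ⊆ K ∧ Approximable T f L := by
  obtain ⟨ρ, hρ, hext⟩ := hX x (f x) 1 one_pos
  obtain ⟨L, hLx, hLK, hL⟩ := local_compact_nhds (inter_mem hKx (Metric.ball_mem_nhds x hρ))
  refine ⟨L, hLx, hL, hLK.trans inter_subset_left, fun ε hε => ?_⟩
  obtain ⟨s, hs, hKs, hsf⟩ := hf (min ε ρ) (lt_min hε hρ)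
  have hx : x ∈ s.source := hKs (mem_of_mem_nhds hKx)
  -- The extension of the germ of `s` lies in `S ∩ T`: as an element of `S` it must equal `s` on
  -- `L`, and as an element of `T` it is the wanted approximant.
  obtain ⟨t, ht, ht1, ht2, -⟩ := hext s (hS.subset s hs) x hx (by rwa [dist_self])
    (lt_of_lt_of_le (hsf x (mem_of_mem_nhds hKx)) (min_le_right _ _))
  refine ⟨t, ht.2, fun z hz => ht1 (hLK hz).2, fun z hz => ?_⟩
  have h1 := hS.eqOn_of_eventuallyEq ht.1 hs (ht1 (Metric.mem_ball_self hρ)) hx ht2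
    ⟨ht1 (hLK hz).2, hKs (hLK hz).1⟩
  rw [h1]
  exact lt_of_lt_of_le (hsf z (hLK hz).1) (min_le_left _ _)

/-- The local transformations that are limits of elements of `S` on every compact subset of their
domain. -/
def limitSystem (S : Set (OpenPartialHomeomorph Z Z)) : Set (OpenPartialHomeomorph Z Z) :=
  {e | ∀ K, IsCompact K → K ⊆ e.source → Approximable S e K}

/-- The same cover works. A member of `limitSystem S` is approximated on the compact set `{x, y}` by
one `s`, however far apart the points are; a map that is only locally a limit would not allow this.
-/
theorem StronglyEquicontinuousOn.limitSystem (hS : StronglyEquicontinuousOn S) :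
    StronglyEquicontinuousOn (limitSystem S) := by
  obtain ⟨C, hC, hS⟩ := hS
  refine ⟨C, hC, fun ε hε => ?_⟩
  obtain ⟨δ, hδ, h⟩ := hS (ε / 2) (half_pos hε)
  refine ⟨δ, hδ, fun e he i j x hx y hy hxi hyi hxj hyj hd => ?_⟩
  have near : ∀ (z : Z) (hz : z ∈ C.space j), ∃ r > 0, ∀ w, dist w z < r →
      ∃ hw : w ∈ C.space j, (C.metric j).dist ⟨w, hw⟩ ⟨z, hz⟩ < ε / 4 := by
    intro z hz
    have h1 : C.ball j ⟨z, hz⟩ (ε / 4) ∈ 𝓝 z :=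
      (hC.isOpen ⟨j, ⟨z, hz⟩, ε / 4, by linarith, rfl⟩).mem_nhds
        ⟨hz, by rw [(C.metric j).dist_self]; linarith⟩
    obtain ⟨r, hr, hrb⟩ := Metric.mem_nhds_iff.1 h1
    exact ⟨r, hr, fun w hw => hrb hw⟩
  obtain ⟨r₁, hr₁, h₁⟩ := near (e x) hxj
  obtain ⟨r₂, hr₂, h₂⟩ := near (e y) hyj
  obtain ⟨s, hs, hsub, hse⟩ := he {x, y} (toFinite _).isCompact (pair_subset hx hy)
    (min r₁ r₂) (lt_min hr₁ hr₂)
  obtain ⟨hsx, hdx⟩ := h₁ (s x) (lt_of_lt_of_le (hse x (by simp)) (min_le_left _ _))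
  obtain ⟨hsy, hdy⟩ := h₂ (s y) (lt_of_lt_of_le (hse y (by simp)) (min_le_right _ _))
  have h3 := h s hs i j x (hsub (by simp)) y (hsub (by simp)) hxi hyi hsx hsy hd
  have t1 := (C.metric j).dist_triangle ⟨e x, hxj⟩ ⟨s x, hsx⟩ ⟨e y, hyj⟩
  have t2 := (C.metric j).dist_triangle ⟨s x, hsx⟩ ⟨s y, hsy⟩ ⟨e y, hyj⟩
  have t3 := (C.metric j).dist_comm ⟨e x, hxj⟩ ⟨s x, hsx⟩
  linarith

end Approximation

/-! ### The compact-open closure in terms of the metric -/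

section LocalClosure

variable {Z : Type u}

open Classical in
/-- A local map, extended by the identity outside of its domain. -/
noncomputable def LocalMap.extend [TopologicalSpace Z] (h : LocalMap Z) (z : Z) : Z :=
  if hz : z ∈ h.dom then h.map ⟨z, hz⟩ else z

theorem LocalMap.extend_apply [TopologicalSpace Z] (h : LocalMap Z) {z : Z} (hz : z ∈ h.dom) :
    h.extend z = h.map ⟨z, hz⟩ := dif_pos hz

theorem LocalMap.continuousOn_extend [TopologicalSpace Z] (h : LocalMap Z) :
    ContinuousOn h.extend h.dom := by
  rw [continuousOn_iff_continuous_domRestrict]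
  exact h.map.continuous.congr fun z => (h.extend_apply z.2).symm

theorem LocalMap.extend_comp [TopologicalSpace Z] (g f : LocalMap Z) {z : Z}
    (hz : z ∈ (g.comp f).dom) : (g.comp f).extend z = g.extend (f.extend z) := by
  obtain ⟨h1, h2⟩ := hz
  rw [LocalMap.extend_apply (g.comp f) (z := z) ⟨h1, h2⟩, f.extend_apply h1, g.extend_apply h2]
  rfl

theorem combination_mem_localClosure [TopologicalSpace Z]
    {S : Set (OpenPartialHomeomorph Z Z)} {𝒢 : Set (LocalMap Z)} {h : LocalMap Z}
    (h𝒢 : 𝒢 ⊆ localClosure S) (hh : h.IsCombination 𝒢) : h ∈ localClosure S := by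
  intro x hx
  obtain ⟨g, hg, hxg⟩ := hh.2 x hx
  obtain ⟨hgh, heq⟩ := hh.1 g hg
  obtain ⟨O, hO, hxO, hcl⟩ := h𝒢 hg x hxg
  refine ⟨O, hO.trans hgh, hxO, ?_⟩
  convert hcl using 1
  ext z
  exact (heq ⟨z, hO z.2⟩).symm

variable [MetricSpace Z] [LocallyCompactSpace Z] {S : Set (OpenPartialHomeomorph Z Z)}

/-- Compact-open convergence is uniform convergence on compact sets. Conversely, approximants on `K`
are restricted to the interior of `K`, which becomes the common domain `O`. -/
theorem mem_localClosure_iff (hrestr : ∀ e ∈ S, ∀ s : Set Z, IsOpen s → e.restr s ∈ S)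
    {h : LocalMap Z} : h ∈ localClosure S ↔ ∀ x ∈ h.dom, ∃ K ∈ 𝓝 x, IsCompact K ∧
      K ⊆ h.dom ∧ Approximable S h.extend K := by
  refine forall₂_congr fun x hx => ⟨?_, ?_⟩
  · rintro ⟨O, hO, hxO, hcl⟩
    obtain ⟨K, hKx, hKO, hK⟩ := local_compact_nhds (O.isOpen.mem_nhds hxO)
    refine ⟨K, hKx, hK, hKO.trans hO, fun ε hε => ?_⟩
    have hK' : IsCompact ((↑) ⁻¹' K : Set O) := by
      refine (IsInducing.subtypeVal.isCompact_preimage_iff ?_).2 hK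
      rw [Subtype.range_coe]
      exact hKO
    have h1 := (ContinuousMap.tendsto_iff_forall_isCompact_tendstoUniformlyOn
      (f := h.resMap O hO) (F := id)).1 tendsto_id _ hK'
    have h2 := Metric.tendstoUniformlyOn_iff.1 h1 ε hε
    obtain ⟨g, ⟨s, hs, hsO, hgs⟩, hg⟩ := ((mem_closure_iff_frequently.1 hcl).and_eventually h2).exists
    refine ⟨s, hs, hsO ▸ hKO, fun z hz => ?_⟩
    have h3 := hg ⟨z, hKO hz⟩ hz
    rw [dist_comm] at h3
    rw [h.extend_apply (hO (hKO hz))]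
    change dist (g ⟨z, hKO hz⟩) _ < ε at h3
    rw [hgs] at h3
    exact h3
  · rintro ⟨K, hKx, hK, hKd, happ⟩
    let O : Opens Z := ⟨interior K, isOpen_interior⟩
    have hO : O ≤ h.dom := interior_subset.trans hKd
    refine ⟨O, hO, mem_interior_iff_mem_nhds.2 hKx, ?_⟩
    choose s hs hKs hsh using fun n : ℕ => happ (1 / (n + 1)) Nat.one_div_pos_of_nat
    let F : ℕ → C(O, Z) := fun n => ⟨fun z => s n z, ((s n).continuousOn.mono
      (interior_subset.trans (hKs n))).domRestrict⟩
    refine mem_closure_of_tendsto (f := F) (b := atTop) ?_ (Eventually.of_forall fun n =>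
      ⟨(s n).restr (interior K), hrestr _ (hs n) _ isOpen_interior, ?_, fun z => rfl⟩)
    · rw [ContinuousMap.tendsto_iff_forall_isCompact_tendstoUniformlyOn]
      intro L _
      rw [Metric.tendstoUniformlyOn_iff]
      intro ε hε
      obtain ⟨N, hN⟩ := exists_nat_one_div_lt hε
      filter_upwards [eventually_ge_atTop N] with n hn z _
      have h1 := hsh n z (interior_subset z.2)
      rw [dist_comm, h.extend_apply (hO z.2)] at h1
      exact h1.trans_le ((Nat.one_div_le_one_div hn).trans hN.le)
    · rw [(s n).restr_source' _ isOpen_interior]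
      exact inter_eq_right.2 (interior_subset.trans (hKs n))

theorem mem_homeoClosure_iff (hrestr : ∀ e ∈ S, ∀ s : Set Z, IsOpen s → e.restr s ∈ S)
    {e : OpenPartialHomeomorph Z Z} : e ∈ homeoClosure S ↔ ∀ x ∈ e.source, ∃ K ∈ 𝓝 x,
      IsCompact K ∧ K ⊆ e.source ∧ Approximable S e K := by
  refine (mem_localClosure_iff hrestr (h := LocalMap.ofHomeo e)).trans (forall₂_congr fun x _ => ?_)
  have key : EqOn (LocalMap.ofHomeo e).extend e e.source := fun z hz =>
    (LocalMap.ofHomeo e).extend_apply hz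
  constructor <;> rintro ⟨K, hKx, hK, hKe, h⟩
  · exact ⟨K, hKx, hK, hKe, h.congr (key.mono hKe)⟩
  · exact ⟨K, hKx, hK, hKe, h.congr (key.mono hKe).symm⟩

end LocalClosure

/-! ### The closure pseudogroup, its orbits and its independence of `S` -/

section ClosurePseudogroup

variable {Z : Type u} [MetricSpace Z] [LocallyCompactSpace Z] {H : StructureGroupoid Z}
  {S T : Set (OpenPartialHomeomorph Z Z)}

theorem IsAdmissible.exists_approximable (hS : IsAdmissible H S) {h : LocalMap Z}
    (hh : h ∈ localClosure S) {x : Z} (hx : x ∈ h.dom) {V : Set Z} (hV : V ∈ 𝓝 x) :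
    ∃ K ∈ 𝓝 x, IsCompact K ∧ K ⊆ h.dom ∧ K ⊆ V ∧ Approximable S h.extend K := by
  obtain ⟨K, hKx, -, hKd, happ⟩ := (mem_localClosure_iff hS.restr).1 hh x hx
  obtain ⟨L, hLx, hLK, hL⟩ := local_compact_nhds (inter_mem hKx hV)
  exact ⟨L, hLx, hL, fun z hz => hKd (hLK hz).1, fun z hz => (hLK hz).2,
    happ.mono fun z hz => (hLK hz).1⟩

theorem IsAdmissible.exists_approximable_homeo (hS : IsAdmissible H S)
    {e : OpenPartialHomeomorph Z Z} (he : e ∈ homeoClosure S) {x : Z} (hx : x ∈ e.source)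
    {V : Set Z} (hV : V ∈ 𝓝 x) :
    ∃ K ∈ 𝓝 x, IsCompact K ∧ K ⊆ e.source ∧ K ⊆ V ∧ Approximable S e K := by
  obtain ⟨K, hKx, -, hKd, happ⟩ := (mem_homeoClosure_iff hS.restr).1 he x hx
  obtain ⟨L, hLx, hLK, hL⟩ := local_compact_nhds (inter_mem hKx hV)
  exact ⟨L, hLx, hL, fun z hz => hKd (hLK hz).1, fun z hz => (hLK hz).2,
    happ.mono fun z hz => (hLK hz).1⟩

theorem IsAdmissible.comp_mem_localClosure (hS : IsAdmissible H S) {g f : LocalMap Z}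
    (hg : g ∈ localClosure S) (hf : f ∈ localClosure S) : g.comp f ∈ localClosure S := by
  rw [mem_localClosure_iff hS.restr]
  intro x hx
  obtain ⟨hxf, hxg⟩ := id hx
  rw [← f.extend_apply hxf] at hxg
  obtain ⟨P, hPx, hP, hPg, -, hPa⟩ := hS.exists_approximable hg hxg univ_mem
  have hcf : ContinuousAt f.extend x := f.continuousOn_extend.continuousAt (f.dom.isOpen.mem_nhds hxf)
  obtain ⟨K, hKx, hK, hKf, hKP, hKa⟩ := hS.exists_approximable hf hxf
    (hcf.preimage_mem_nhds (interior_mem_nhds.2 hPx))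
  have hKd : K ⊆ (g.comp f).dom := fun z hz =>
    ⟨hKf hz, by rw [← f.extend_apply (hKf hz)]; exact hPg (interior_subset (hKP hz))⟩
  refine ⟨K, hKx, hK, hKd, (hKa.comp hS.comp hK hP (f.continuousOn_extend.mono hKf) hPa
    (g.continuousOn_extend.mono hPg) (image_subset_iff.2 hKP)).congr fun z hz => ?_⟩
  exact (g.extend_comp f (hKd hz)).symm

theorem IsAdmissible.restr_mem_localClosure (hS : IsAdmissible H S) {h : LocalMap Z}
    (hh : h ∈ localClosure S) (O : Opens Z) (hO : O ≤ h.dom) : h.restr O hO ∈ localClosure S := by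
  rw [mem_localClosure_iff hS.restr]
  intro x hx
  obtain ⟨K, hKx, hK, -, hKO, hKa⟩ := hS.exists_approximable hh (hO hx) (O.isOpen.mem_nhds hx)
  refine ⟨K, hKx, hK, hKO, hKa.congr fun z hz => ?_⟩
  rw [h.extend_apply (hO (hKO hz)), LocalMap.extend_apply (h.restr O hO) (hKO hz)]
  rfl

theorem IsAdmissible.isLocalHomeomorph (hS : IsAdmissible H S) (hX : HasUniformExtensions H S)
    {h : LocalMap Z} (hh : h ∈ localClosure S) : IsLocalHomeomorph h.map := by
  refine isLocalHomeomorph_iff_isOpenEmbedding_restrict.2 fun x => ?_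
  obtain ⟨K, hKx, hK, hKd, -, hKa⟩ := hS.exists_approximable hh x.2 univ_mem
  refine ⟨(↑) ⁻¹' interior K,
    continuous_subtype_val.continuousAt.preimage_mem_nhds (interior_mem_nhds.2 hKx), ?_⟩
  refine IsOpenEmbedding.of_continuous_injective_isOpenMap
    (h.map.continuous.comp continuous_subtype_val) ?_ ?_
  · rintro ⟨⟨a, had⟩, ha⟩ ⟨⟨b, hbd⟩, hb⟩ hab
    change h.map ⟨a, had⟩ = h.map ⟨b, hbd⟩ at hab
    rw [← h.extend_apply had, ← h.extend_apply hbd] at hab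
    have : a = b := (hKa.mono (pair_subset (interior_subset ha) (interior_subset hb))).eq_of_apply_eq
      hS hX hab
    subst this
    rfl
  · rw [isOpenMap_iff_nhds_le]
    rintro ⟨⟨a, had⟩, ha⟩
    refine le_map fun s hs => ?_
    rw [nhds_subtype_eq_comap, nhds_subtype_eq_comap, comap_comap, mem_comap] at hs
    obtain ⟨W, hW, hWs⟩ := hs
    obtain ⟨L, hLa, hLW, hL⟩ := local_compact_nhds
      (inter_mem hW (isOpen_interior.mem_nhds ha))
    have hLK : L ⊆ K := fun z hz => interior_subset (hLW hz).2
    have h1 := (hKa.mono hLK).image_mem_nhds hS hX hL hLa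
      (h.continuousOn_extend.mono (hLK.trans hKd))
    rw [h.extend_apply had] at h1
    refine mem_of_superset h1 ?_
    rintro _ ⟨z, hz, rfl⟩
    rw [h.extend_apply (hKd (hLK hz))]
    exact ⟨⟨⟨z, hKd (hLK hz)⟩, (hLW hz).2⟩, hWs (hLW hz).1, rfl⟩

theorem IsAdmissible.subset_homeoClosure (hS : IsAdmissible H S) {h : OpenPartialHomeomorph Z Z}
    (hh : h ∈ H) : h ∈ homeoClosure S := by
  rw [mem_homeoClosure_iff hS.restr]
  intro x hx
  obtain ⟨s, hs, hxs, hsh⟩ := hS.toIsGeneratingSystem.exists_germ hh hx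
  obtain ⟨K, hKx, hKV, hK⟩ := local_compact_nhds (inter_mem hsh
    (inter_mem (s.open_source.mem_nhds hxs) (h.open_source.mem_nhds hx)))
  exact ⟨K, hKx, hK, fun z hz => (hKV hz).2.2,
    (approximable_of_mem hs fun z hz => (hKV hz).2.1).congr fun z hz => (hKV hz).1⟩

/-- The pseudogroup of the homeomorphisms that are locally limits of elements of `S`. -/
def IsAdmissible.closurePseudogroup (hS : IsAdmissible H S) (hX : HasUniformExtensions H S) :
    StructureGroupoid Z where
  members := homeoClosure S
  trans' e e' he he' := by
    rw [mem_homeoClosure_iff hS.restr]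
    intro x hx
    rw [e.trans_source] at hx
    obtain ⟨P, hPx, hP, hPe, -, hPa⟩ := hS.exists_approximable_homeo he' hx.2 univ_mem
    obtain ⟨K, hKx, hK, hKe, hKP, hKa⟩ := hS.exists_approximable_homeo he hx.1
      ((e.continuousAt hx.1).preimage_mem_nhds (interior_mem_nhds.2 hPx))
    refine ⟨K, hKx, hK, fun z hz => ?_, hKa.comp (f := e) (g := e') hS.comp hK hP (e.continuousOn.mono hKe) hPa
      (e'.continuousOn.mono hPe) (image_subset_iff.2 hKP)⟩
    rw [e.trans_source]
    exact ⟨hKe hz, hPe (interior_subset (hKP hz))⟩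
  symm' e he := by
    rw [mem_homeoClosure_iff hS.restr]
    intro y hy
    obtain ⟨K, hKx, hK, hKe, -, hKa⟩ :=
      hS.exists_approximable_homeo he (e.map_target hy) univ_mem
    have hi := interior_subset.trans hKe
    obtain ⟨L, hLy, hLK, hL⟩ := local_compact_nhds
      ((e.isOpen_image_of_subset_source isOpen_interior hi).mem_nhds
        ⟨e.symm y, mem_interior_iff_mem_nhds.2 hKx, e.right_inv hy⟩)
    refine ⟨L, hLy, hL, fun w hw => ?_, hKa.symm hS hX hK hKe hL hLK⟩
    obtain ⟨z, hz, rfl⟩ := hLK hw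
    exact e.map_source (hi hz)
  id_mem' := hS.subset_homeoClosure H.id_mem
  locality' e he := by
    rw [mem_homeoClosure_iff hS.restr]
    intro x hx
    obtain ⟨s, hs, hxs, hes⟩ := he x hx
    obtain ⟨K, hKx, hK, hKe, -, hKa⟩ := hS.exists_approximable_homeo hes
      ((mem_restr_source hs).2 ⟨hx, hxs⟩) univ_mem
    exact ⟨K, hKx, hK, fun z hz => (hKe hz).1, hKa⟩
  mem_of_eqOnSource' e e' he hee := by
    rw [mem_homeoClosure_iff hS.restr]
    intro x hx
    rw [hee.source_eq] at hx
    obtain ⟨K, hKx, hK, hKe, -, hKa⟩ := hS.exists_approximable_homeo he hx univ_mem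
    exact ⟨K, hKx, hK, hKe.trans hee.source_eq.superset,
      hKa.congr (hee.eqOn.symm.mono (hKe.trans hee.source_eq.superset))⟩

theorem IsAdmissible.mem_closurePseudogroup (hS : IsAdmissible H S)
    (hX : HasUniformExtensions H S) {e : OpenPartialHomeomorph Z Z} :
    e ∈ hS.closurePseudogroup hX ↔ e ∈ homeoClosure S := Iff.rfl

theorem IsAdmissible.closedUnderRestriction_closurePseudogroup (hS : IsAdmissible H S)
    (hX : HasUniformExtensions H S) : ClosedUnderRestriction (hS.closurePseudogroup hX) where
  closedUnderRestriction {e} he s hs := by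
    rw [hS.mem_closurePseudogroup, mem_homeoClosure_iff hS.restr]
    intro x hx
    obtain ⟨K, hKx, hK, -, hKs, hKa⟩ := hS.exists_approximable_homeo he
      ((mem_restr_source hs).1 hx).1 ((e.restr s).open_source.mem_nhds hx)
    exact ⟨K, hKx, hK, hKs, hKa⟩

/-- Local compactness inserts a compact neighborhood between a compact set and the open domain
containing it, which is the room that `Approximable.comp` and `Approximable.symm` need. Restriction
to the interior of a compact set of approximation puts every germ in the system. -/
theorem IsAdmissible.isGeneratingSystem_limitSystem (hS : IsAdmissible H S)
    (hX : HasUniformExtensions H S) :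
    IsGeneratingSystem (hS.closurePseudogroup hX) (limitSystem S) where
  subset e he := by
    rw [hS.mem_closurePseudogroup, mem_homeoClosure_iff hS.restr]
    intro x hx
    obtain ⟨K, hKx, hKe, hK⟩ := local_compact_nhds (e.open_source.mem_nhds hx)
    exact ⟨K, hKx, hK, hKe, he K hK hKe⟩
  generates e he := by
    refine Generated.of_exists_germ
      (fun e he s _ K hK hKe => he K hK fun z hz => (hKe hz).1) fun x hx => ?_
    obtain ⟨K, hKx, -, -, -, hKa⟩ := hS.exists_approximable_homeo he hx univ_mem
    refine ⟨e.restr (interior K), fun L _ hL => hKa.mono fun z hz => ?_, ?_, EventuallyEq.rfl⟩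
    · exact interior_subset ((mem_restr_source isOpen_interior).1 (hL hz)).2
    · exact (mem_restr_source isOpen_interior).2 ⟨hx, mem_interior_iff_mem_nhds.2 hKx⟩
  symm e he L hL hLe := by
    have himg : e.symm '' L ⊆ e.source := by
      rintro _ ⟨w, hw, rfl⟩
      exact e.map_target (hLe hw)
    obtain ⟨K, hK, hLK, hKe⟩ := exists_compact_between
      (hL.image_of_continuousOn (e.symm.continuousOn.mono hLe)) e.open_source himg
    exact (he K hK hKe).symm hS hX hK hKe hL fun w hw =>
      ⟨e.symm w, hLK (mem_image_of_mem _ hw), e.right_inv (hLe hw)⟩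
  comp e he e' he' K hK hKe := by
    rw [e.trans_source] at hKe
    have hK1 : K ⊆ e.source := fun z hz => (hKe hz).1
    obtain ⟨P, hP, hKP, hPe⟩ := exists_compact_between
      (hK.image_of_continuousOn (e.continuousOn.mono hK1)) e'.open_source
      (image_subset_iff.2 fun z hz => (hKe hz).2)
    exact (he K hK hK1).comp (f := e) (g := e') hS.comp hK hP (e.continuousOn.mono hK1) (he' P hP hPe)
      (e'.continuousOn.mono hPe) hKP
  congr e he e' hee K hK hKe := by
    exact (he K hK (hKe.trans hee.source_eq.subset)).congr (hee.eqOn.symm.mono hKe)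

theorem IsAdmissible.exists_localClosure_apply_eq (hS : IsAdmissible H S)
    (hX : HasUniformExtensions H S) {x y : Z} (hy : y ∈ closure (orbit H x)) :
    ∃ h ∈ localClosure S, ∃ hx : x ∈ h.dom, h.map ⟨x, hx⟩ = y := by
  obtain ⟨M, hM, hMy⟩ := exists_compact_mem_nhds y
  obtain ⟨ε, hε, hεM⟩ := Metric.mem_nhds_iff.1 hMy
  obtain ⟨ρ, hρ, hext⟩ := hX x y ε hε
  obtain ⟨N, hNx, hNρ, hN⟩ := local_compact_nhds (Metric.ball_mem_nhds x hρ)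
  have hseq : ∀ n : ℕ, ∃ t ∈ S, Metric.ball x ρ ⊆ t.source ∧ dist (t x) y < 1 / (n + 1) ∧
      ∀ z ∈ Metric.ball x ρ, t z ∈ M := by
    intro n
    obtain ⟨_, ⟨h, hh, hx, rfl⟩, hd⟩ := Metric.mem_closure_iff.1 hy (min ρ (1 / (n + 1)))
      (lt_min hρ Nat.one_div_pos_of_nat)
    rw [dist_comm, lt_min_iff] at hd
    obtain ⟨t, ht, ht1, ht2, ht3⟩ := hext h hh x hx (by rwa [dist_self]) hd.1
    exact ⟨t, ht, ht1, by rw [ht2.eq_of_nhds]; exact hd.2, fun z hz => hεM (ht3 z hz)⟩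
  choose t ht ht1 ht2 ht3 using hseq
  have : CompactSpace N := isCompact_iff_compactSpace.1 hN
  let F : ℕ → BoundedContinuousFunction N Z := fun n => BoundedContinuousFunction.mkOfCompact
    ⟨fun z => t n z, ((t n).continuousOn.mono (hNρ.trans (ht1 n))).domRestrict⟩
  -- Arzelà–Ascoli: all values lie in the compact set `M`, and elements of `S` sending `a` into `M`
  -- are equicontinuous at `a`.
  have hcompact : IsCompact (closure (range F)) := by
    refine BoundedContinuousFunction.arzela_ascoli M hM _ ?_ ?_
    · rintro _ z ⟨n, rfl⟩
      exact ht3 n z (hNρ z.2)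
    · intro a
      rw [Metric.equicontinuousAt_iff]
      intro ε' hε'
      obtain ⟨δ, hδ, h⟩ := hS.exists_dist_lt_of_apply_mem hX hM (a : Z) hε'
      refine ⟨δ, hδ, ?_⟩
      rintro z hz ⟨_, n, rfl⟩
      rw [dist_comm]
      exact h (t n) (ht n) (ht1 n (hNρ a.2)) (ht3 n a (hNρ a.2)) z (ht1 n (hNρ z.2)) hz
  obtain ⟨f, -, φ, hφ, hlim⟩ := hcompact.tendsto_subseq fun n => subset_closure (mem_range_self n)
  have hxN : x ∈ interior N := mem_interior_iff_mem_nhds.2 hNx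
  let h : LocalMap Z := ⟨⟨interior N, isOpen_interior⟩,
    ⟨fun z => f ⟨z, interior_subset z.2⟩, f.continuous.comp
      (continuous_subtype_val.subtype_mk _)⟩⟩
  refine ⟨h, (mem_localClosure_iff hS.restr).2 fun z hz => ?_, hxN, ?_⟩
  · obtain ⟨K, hKz, hKN, hK⟩ := local_compact_nhds (isOpen_interior.mem_nhds hz)
    refine ⟨K, hKz, hK, hKN, fun ε' hε' => ?_⟩
    obtain ⟨n, hn⟩ := (Metric.tendsto_nhds.1 hlim ε' hε').exists
    refine ⟨t (φ n), ht _, fun w hw => ht1 _ (hNρ (interior_subset (hKN hw))), fun w hw => ?_⟩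
    rw [h.extend_apply (hKN hw)]
    exact (BoundedContinuousFunction.dist_coe_le_dist (f := F (φ n)) (g := f)
      ⟨w, interior_subset (hKN hw)⟩).trans_lt hn
  · have l1 : Tendsto (fun n => t (φ n) x) atTop (𝓝 (f ⟨x, interior_subset hxN⟩)) :=
      ((continuous_eval_const _).tendsto f).comp hlim
    have l2 : Tendsto (fun n => t n x) atTop (𝓝 y) := by
      rw [tendsto_iff_dist_tendsto_zero]
      exact squeeze_zero (fun _ => dist_nonneg) (fun n => (ht2 n).le)
        tendsto_one_div_add_atTop_nhds_zero_nat
    exact tendsto_nhds_unique l1 (l2.comp hφ.tendsto_atTop)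

/-- A map of the closure is a local homeomorphism, so shrinking its domain around `x` gives a member
of the pseudogroup with the same value; this passes from limit maps to orbits. -/
theorem IsAdmissible.exists_homeoClosure_apply_eq (hS : IsAdmissible H S)
    (hX : HasUniformExtensions H S) {h : LocalMap Z} (hh : h ∈ localClosure S) {x : Z}
    (hx : x ∈ h.dom) : ∃ e ∈ homeoClosure S, x ∈ e.source ∧ e x = h.map ⟨x, hx⟩ := by
  obtain ⟨e, hxe, he⟩ := hS.isLocalHomeomorph hX hh ⟨x, hx⟩
  let c := h.dom.openPartialHomeomorphSubtypeCoe ⟨⟨x, hx⟩⟩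
  have hsource : ∀ z ∈ (c.symm.trans e).source, z ∈ h.dom := by
    intro z hz
    rw [OpenPartialHomeomorph.trans_source] at hz
    simpa [c] using hz.1
  have hc : ∀ z (hz : z ∈ h.dom), c.symm z = ⟨z, hz⟩ := fun z hz =>
    c.left_inv (x := ⟨z, hz⟩) (by simp [c])
  have hval : ∀ z (hz : z ∈ h.dom), (c.symm.trans e) z = h.map ⟨z, hz⟩ := by
    intro z hz
    rw [OpenPartialHomeomorph.coe_trans, Function.comp_apply, hc z hz, he]
  have hxs : x ∈ (c.symm.trans e).source := by
    rw [OpenPartialHomeomorph.trans_source]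
    refine ⟨by simpa [c] using hx, ?_⟩
    rw [mem_preimage, hc x hx]
    exact hxe
  refine ⟨c.symm.trans e, (mem_homeoClosure_iff hS.restr).2 fun z hz => ?_, hxs, hval x hx⟩
  obtain ⟨K, hKz, hK, hKd, hKs, hKa⟩ := hS.exists_approximable hh (hsource z hz)
    ((c.symm.trans e).open_source.mem_nhds hz)
  refine ⟨K, hKz, hK, hKs, hKa.congr fun w hw => ?_⟩
  rw [hval w (hKd hw), h.extend_apply (hKd hw)]

theorem IsAdmissible.orbit_closurePseudogroup (hS : IsAdmissible H S)
    (hX : HasUniformExtensions H S) (x : Z) :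
    orbit (hS.closurePseudogroup hX) x = closure (orbit H x) := by
  ext y
  constructor
  · rintro ⟨e, he, hx, rfl⟩
    obtain ⟨K, hKx, -, -, -, hKa⟩ := hS.exists_approximable_homeo he hx univ_mem
    refine Metric.mem_closure_iff.2 fun ε hε => ?_
    obtain ⟨s, hs, hKs, hse⟩ := hKa ε hε
    have hxK := mem_of_mem_nhds hKx
    exact ⟨s x, ⟨s, hS.subset s hs, hKs hxK, rfl⟩, by rw [dist_comm]; exact hse x hxK⟩
  · intro hy
    obtain ⟨h, hh, hx, rfl⟩ := hS.exists_localClosure_apply_eq hX hy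
    obtain ⟨e, he, hxe, hex⟩ := hS.exists_homeoClosure_apply_eq hX hh hx
    exact ⟨e, he, hxe, hex⟩

theorem IsAdmissible.localClosure_subset (hS : IsAdmissible H S) (hT : IsAdmissible H T)
    (hX : HasUniformExtensions H (S ∩ T)) : localClosure S ⊆ localClosure T := by
  intro h hh
  rw [mem_localClosure_iff hT.restr]
  intro x hx
  obtain ⟨K, hKx, -, hKd, -, hKa⟩ := hS.exists_approximable hh hx univ_mem
  obtain ⟨L, hLx, hL, hLK, hLa⟩ := hKa.exists_nhds_of_isAdmissible hS hX hKx
  exact ⟨L, hLx, hL, hLK.trans hKd, hLa⟩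

theorem IsAdmissible.localClosure_eq [ClosedUnderRestriction H] (hcg : IsCompactlyGenerated H)
    (hS : IsAdmissible H S) (hT : IsAdmissible H T) : localClosure S = localClosure T :=
  (hS.localClosure_subset hT ((hS.inter hT).hasUniformExtensions hcg)).antisymm
    (hT.localClosure_subset hS ((hT.inter hS).hasUniformExtensions hcg))

end ClosurePseudogroup

end PseudogroupClosure

theorem theoremt {Z : Type u} [TopologicalSpace Z] [PolishSpace Z] [LocallyCompactSpace Z]
    (H : StructureGroupoid Z) [ClosedUnderRestriction H]
    (hqe : PseudogroupClosure.IsQuasiEffective H)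
    (hcg : PseudogroupClosure.IsCompactlyGenerated H)
    (hse : PseudogroupClosure.IsStronglyEquicontinuous H) :
    (∃ S, PseudogroupClosure.IsAdmissible H S) ∧
    ∀ S, PseudogroupClosure.IsAdmissible H S →
      -- closed under composition, combination and restriction to open sets
      ((∀ g ∈ PseudogroupClosure.localClosure S, ∀ f ∈ PseudogroupClosure.localClosure S,
          g.comp f ∈ PseudogroupClosure.localClosure S) ∧
        (∀ (𝒢 : Set (PseudogroupClosure.LocalMap Z)) (h : PseudogroupClosure.LocalMap Z),
          𝒢 ⊆ PseudogroupClosure.localClosure S → h.IsCombination 𝒢 →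
            h ∈ PseudogroupClosure.localClosure S) ∧
        (∀ h ∈ PseudogroupClosure.localClosure S, ∀ (O : Opens Z) (hO : O ≤ h.dom),
          h.restr O hO ∈ PseudogroupClosure.localClosure S)) ∧
      -- local homeomorphisms
      (∀ h ∈ PseudogroupClosure.localClosure S, IsLocalHomeomorph h.map) ∧
      -- the homeomorphisms form a strongly equicontinuous pseudogroup containing `H`,
      -- whose orbits are the closures of the orbits of `H`
      (∃ K : StructureGroupoid Z, ClosedUnderRestriction K ∧
        K.members = PseudogroupClosure.homeoClosure S ∧
        (∀ h ∈ H, h ∈ K) ∧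
        PseudogroupClosure.IsStronglyEquicontinuous K ∧
        (∀ x : Z, PseudogroupClosure.orbit K x = closure (PseudogroupClosure.orbit H x))) ∧
      -- independence of the choice of `S`
      (∀ S', PseudogroupClosure.IsAdmissible H S' →
        PseudogroupClosure.localClosure S' = PseudogroupClosure.localClosure S ∧
        PseudogroupClosure.homeoClosure S' = PseudogroupClosure.homeoClosure S) := by

  -- The metric is auxiliary: the statement mentions only the topology, and the metrics of the
  -- covers are compared with this one locally.
  let _ := metrizableSpaceMetric Z
  refine ⟨PseudogroupClosure.exists_isAdmissible hqe hse, fun S hS => ?_⟩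
  have hX := hS.hasUniformExtensions hcg
  refine ⟨⟨fun g hg f hf => hS.comp_mem_localClosure hg hf,
    fun 𝒢 h h𝒢 hh => PseudogroupClosure.combination_mem_localClosure h𝒢 hh,
    fun h hh O hO => hS.restr_mem_localClosure hh O hO⟩,
    fun h hh => hS.isLocalHomeomorph hX hh,
    ⟨hS.closurePseudogroup hX, hS.closedUnderRestriction_closurePseudogroup hX, rfl,
      fun h hh => hS.subset_homeoClosure hh,
      ⟨_, hS.isGeneratingSystem_limitSystem hX, hS.stronglyEquicontinuous.limitSystem⟩,
      fun x => hS.orbit_closurePseudogroup hX x⟩, fun S' hS' => ?_⟩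
  have heq := hS'.localClosure_eq hcg hS
  exact ⟨heq, by simp only [PseudogroupClosure.homeoClosure, heq]⟩
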